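/- Let $n\ge 2$. For qubits $i\ne j$ of an $n$-qubit register consider the skew-Hermitian operators $$h_x^{ij}=-\tfrac{i}{4}\,(\sigma_x^i\sigma_x^j+\sigma_y^i\sigma_y^j)\prod_{k}\sigma_z^k,\qquad h_y^{ij}=-\tfrac{i}{4}\,(\sigma_y^i\sigma_x^j-\sigma_x^i\sigma_y^j)\prod_{k}\sigma_z^k,\qquad h_z^{ij}=-\tfrac{i}{4}\,(\sigma_z^i-\sigma_z^j),$$ where the products run over the qubits $k$ strictly between $i$ and $j$. They are the generators of the $\mathrm{SU}$ compound ansatz, and the real Lie algebra that they generate is its dynamical Lie algebra (DLA). Let $\phi$ be the representation of $\mathrm{SU}(n)$ on $\bigoplus_{k=0}^n\bigwedge^k\mathbb C^n\cong(\mathbb C^2)^{\otimes n}$, where the computational basis state with ones exactly at the qubits $i_1<\dots<i_k$ is identified with $e_{i_1}\wedge\dots\wedge e_{i_k}$, let $d\phi$ be its differential, and put $\|a\|_{\mathfrak g}^2=-\operatorname{Tr}(a^2)$ for $a\in\mathfrak{su}(n)$. For a skew-Hermitian $H$, a Hermitian $O$ and a state $\rho$ let $\mathrm{GradVar}$ be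 the variance, for independent Haar-random $g^+,g^-\in\mathrm{SU}(n)$, of $$\operatorname{Tr}\bigl\{\phi(g^-)^\dagger\rho\,\phi(g^-)\,[H,\phi(g^+)\,O\,\phi(g^+)^\dagger]\bigr\}.$$ The ansatz is a Lie algebra supported ansatz (LASA) if $iO$ belongs to the DLA. Let $\rho=(|+\rangle\langle +|)^{\otimes n}$. Then: 1. The DLA equals $d\phi(\mathfrak{su}(n))$ and has dimension $n^2-1$, and every generator is $d\phi(h)$ for some $h\in\mathfrak{su}(n)$ with $\|h\|_{\mathfrak g}^2=\tfrac12$. 2. If $H=d\phi(h)$ and $iO=d\phi(o)$ with $h,o\in\mathfrak{su}(n)$, then $$\mathrm{GradVar}=\frac{n(n-1)}{4(n^2-1)^2}\,\|h\|_{\mathfrak g}^2\,\|o\|_{\mathfrak g}^2 .$$ In particular, if $H$ is any generator and $O=\pm i$ times any generator, then $$\mathrm{GradVar}=\frac{n(n-1)}{16(n^2-1)^2}.$$ 3. Consequently, for every sequence (in $n$) of generators $H$ and of LASA observables $O$, $iO=d\phi(o)$, with $\|o\|_{\mathfrak g}^2=\Theta(1)$, one has $\mathrm{GradVar}=\Theta(1/n^2)$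 as $n\to\infty$; equivalently, $\mathrm{GradVar}$ is of the order of the inverse of the DLA dimension, $\Theta(1/(n^2-1))$. -/

import Mathlib

open scoped Matrix

attribute [local instance 100] LieRing.ofAssociativeRing

namespace CompoundAnsatz

/-! ### Qubits and Pauli operators -/

/-- Labels of the computational basis states of `n` qubits. -/
abbrev Bits (n : ℕ) : Type := Fin n → Fin 2

/-- Operators on the `n`-qubit Hilbert space, in the computational basis. -/
abbrev QOp (n : ℕ) : Type := Matrix (Bits n) (Bits n) ℂ

/-- The Pauli matrix `σ_x`. -/
def σx : Matrix (Fin 2) (Fin 2) ℂ := !![0, 1; 1, 0]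

/-- The Pauli matrix `σ_y`. -/
def σy : Matrix (Fin 2) (Fin 2) ℂ := !![0, -Complex.I; Complex.I, 0]

/-- The Pauli matrix `σ_z`. -/
def σz : Matrix (Fin 2) (Fin 2) ℂ := !![1, 0; 0, -1]

/-- The tensor product `P 0 ⊗ P 1 ⊗ ⋯ ⊗ P (n - 1)` of one-qubit operators. -/
def tensorOp {n : ℕ} (P : Fin n → Matrix (Fin 2) (Fin 2) ℂ) : QOp n :=
  Matrix.of fun x y => ∏ k, P k (x k) (y k)

/-- The operator with `A` on qubit `i`, `B` on qubit `j`, `σ_z` on every qubit strictly between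
`i` and `j`, and the identity on all other qubits. -/
def pauliString {n : ℕ} (A B : Matrix (Fin 2) (Fin 2) ℂ) (i j : Fin n) : QOp n :=
  tensorOp fun k =>
    if k = i then A
    else if k = j then B
    else if min i j < k ∧ k < max i j then σz
    else 1

/-- The one-qubit operator `A` acting on qubit `i`. -/
def onQubit {n : ℕ} (A : Matrix (Fin 2) (Fin 2) ℂ) (i : Fin n) : QOp n :=
  tensorOp fun k => if k = i then A else 1

/-! ### Generators of the compound ansatz, its dynamical Lie algebra -/

/-- `-(i/4) (σ_x^i σ_x^j + σ_y^i σ_y^j) σ_z ⋯ σ_z`. -/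
noncomputable def genX {n : ℕ} (i j : Fin n) : QOp n :=
  (-(Complex.I / 4)) • (pauliString σx σx i j + pauliString σy σy i j)

/-- `-(i/4) (σ_y^i σ_x^j - σ_x^i σ_y^j) σ_z ⋯ σ_z`. -/
noncomputable def genY {n : ℕ} (i j : Fin n) : QOp n :=
  (-(Complex.I / 4)) • (pauliString σy σx i j - pauliString σx σy i j)

/-- `-(i/4) (σ_z^i - σ_z^j)`. -/
noncomputable def genZ {n : ℕ} (i j : Fin n) : QOp n :=
  (-(Complex.I / 4)) • (onQubit σz i - onQubit σz j)

/-- The skew-Hermitian generators of the gates of the `SU` compound ansatz on `n` qubits. -/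
def generators (n : ℕ) : Set (QOp n) :=
  {H | ∃ i j : Fin n, i ≠ j ∧ (H = genX i j ∨ H = genY i j ∨ H = genZ i j)}

/-- The dynamical Lie algebra: the real Lie algebra generated by the gate generators. -/
noncomputable def dla (n : ℕ) : LieSubalgebra ℝ (QOp n) :=
  LieSubalgebra.lieSpan ℝ (QOp n) (generators n)

/-- The ansatz with observable `O` is a Lie algebra supported ansatz: `i O` lies in the
dynamical Lie algebra. -/
def IsLASA (n : ℕ) (O : QOp n) : Prop := Complex.I • O ∈ dla n

/-! ### The compound representation of `SU(n)` -/

/-- The group `SU(n)`. -/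
abbrev SUn (n : ℕ) : Type := Matrix.specialUnitaryGroup (Fin n) ℂ

/-- The set of qubits on which a bit string is `1`. -/
def bitsEquivFinset (n : ℕ) : Bits n ≃ Finset (Fin n) where
  toFun x := Finset.univ.filter fun i => x i = 1
  invFun s i := if i ∈ s then 1 else 0
  left_inv x := by
    funext i
    rcases Fin.exists_fin_two.mp ⟨x i, rfl⟩ with h | h <;> simp [h]
  right_inv s := by
    ext i
    simp

/-- The basis of `⋀ ℂⁿ` formed by the vectors `e_{i₁} ∧ ⋯ ∧ e_{iₖ}` with `i₁ < ⋯ < iₖ`, such a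
vector being labelled by the computational basis state whose ones are at `i₁, …, iₖ`. -/
noncomputable def wedgeBasis (n : ℕ) : Module.Basis (Bits n) ℂ (ExteriorAlgebra ℂ (Fin n → ℂ)) :=
  (Pi.basisFun ℂ (Fin n)).ExteriorAlgebra.reindex (bitsEquivFinset n).symm

/-- The compound matrix of `g`: the matrix of `⨁ₖ ⋀ᵏ g` on `⨁ₖ ⋀ᵏ ℂⁿ`, which is identified with
the `n`-qubit space through `wedgeBasis`. On `SU(n)` this is the representation `φ`. -/
noncomputable def compound {n : ℕ} (g : Matrix (Fin n) (Fin n) ℂ) : QOp n :=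
  LinearMap.toMatrix (wedgeBasis n) (wedgeBasis n)
    (ExteriorAlgebra.map (Matrix.toLin' g)).toLinearMap

/-- The Lie algebra `su(n)` of traceless skew-Hermitian matrices. -/
def su (n : ℕ) : Set (Matrix (Fin n) (Fin n) ℂ) := {a | aᴴ = -a ∧ a.trace = 0}

/-- The squared standard norm `‖a‖² = -Tr (a²)` on `su(n)`. -/
noncomputable def stdNormSq {n : ℕ} (a : Matrix (Fin n) (Fin n) ℂ) : ℝ := -((a * a).trace).re

/-- The differential of the compound representation:
`dφ(a) = d/dt φ(exp(t a))` at `t = 0`, entry by entry. -/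
noncomputable def dcompound {n : ℕ} (a : Matrix (Fin n) (Fin n) ℂ) : QOp n :=
  Matrix.of fun x y => deriv (fun t : ℝ => compound (NormedSpace.exp (t • a)) x y) 0

/-! ### Haar measure on `SU(n)` -/

instance instContinuousInvSUn (n : ℕ) : ContinuousInv (SUn n) where
  continuous_inv := by
    refine Continuous.subtype_mk ?_ _
    exact continuous_star.comp continuous_subtype_val

instance instIsTopologicalGroupSUn (n : ℕ) : IsTopologicalGroup (SUn n) where

instance instCompactSpaceSUn (n : ℕ) : CompactSpace (SUn n) := by
  refine isCompact_iff_compactSpace.mp ?_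
  have hK : IsCompact {A : Matrix (Fin n) (Fin n) ℂ |
      ∀ i, A i ∈ {v : Fin n → ℂ | ∀ j, v j ∈ Metric.closedBall (0 : ℂ) 1}} :=
    isCompact_pi_infinite fun _ => isCompact_pi_infinite fun _ => isCompact_closedBall 0 1
  refine hK.of_isClosed_subset ?_ ?_
  · have h : ((Matrix.specialUnitaryGroup (Fin n) ℂ : Submonoid (Matrix (Fin n) (Fin n) ℂ)) :
        Set (Matrix (Fin n) (Fin n) ℂ)) = {A | A * star A = 1} ∩ {A | A.det = 1} := by
      ext A
      simp [Matrix.mem_specialUnitaryGroup_iff, Matrix.mem_unitaryGroup_iff]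
    rw [h]
    exact (isClosed_eq (by fun_prop) continuous_const).inter
      (isClosed_eq (by fun_prop) continuous_const)
  · intro A hA i j
    simpa using entry_norm_bound_of_unitary (Matrix.mem_specialUnitaryGroup_iff.mp hA).1 i j

noncomputable instance instMeasurableSpaceSUn (n : ℕ) : MeasurableSpace (SUn n) := borel _

instance instBorelSpaceSUn (n : ℕ) : BorelSpace (SUn n) := ⟨rfl⟩

/-- The Haar probability measure on `SU(n)`. -/
noncomputable def haarSU (n : ℕ) : MeasureTheory.Measure (SUn n) :=
  MeasureTheory.Measure.haarMeasure ⊤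

/-! ### Gradient variance -/

/-- The abstracted gradient
`∂⟨O⟩_ρ = Tr (U₋† ρ U₋ [H, U₊ O U₊†])` with `U₊ = φ(g⁺)` and `U₋ = φ(g⁻)`. -/
noncomputable def gradient {n : ℕ} (H O ρ : QOp n) (gplus gminus : SUn n) : ℂ :=
  ((compound gminus.1)ᴴ * ρ * compound gminus.1 *
    ⁅H, compound gplus.1 * O * (compound gplus.1)ᴴ⁆).trace

/-- The variance of the abstracted gradient for independent Haar random `g⁺, g⁻` in `SU(n)`.
For skew-Hermitian `H` and Hermitian `O`, `ρ` the gradient is a real number. -/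
noncomputable def gradVar {n : ℕ} (H O ρ : QOp n) : ℝ :=
  ProbabilityTheory.variance (fun p : SUn n × SUn n => (gradient H O ρ p.1 p.2).re)
    ((haarSU n).prod (haarSU n))

/-- The state vector `|+⟩^{⊗ n}`, where `|+⟩ = (|0⟩ + |1⟩) / √2`. -/
noncomputable def plusVec (n : ℕ) : Bits n → ℂ := fun _ => ∏ _k : Fin n, ((1 / √2 : ℝ) : ℂ)

/-- The density matrix of the uniform superposition `|+⟩^{⊗ n}`. -/
noncomputable def plusState (n : ℕ) : QOp n := Matrix.vecMulVec (plusVec n) (star (plusVec n))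

end CompoundAnsatz

open CompoundAnsatz Filter Asymptotics

/-! Under the Jordan–Wigner transformation the qubit register is the fermionic Fock space over ℂⁿ:
`cr i` is exterior multiplication by e_i, and increasing wedges are computational basis states
without signs. Hence `compound g` is the only operator that fixes the vacuum and satisfies U a†(v) =
a†(gv) U (`eq_compound`), and its differential is the one-body operator ∑ a_ij a†_i a_j
(`dcompound_eq_oneBody`). The generators are images of elementary elements of su(n) that already
span it over ℝ, so the DLA is the image of su(n) (`dla_eq_suImage`); its dimension follows from
`oneBody_injective`.

For the variance, conjugation by φ(g) acts on one-body operators as x ↦ g x g†, and the plus state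
sees them only through P = `plusMat`. The gradient becomes the n × n expression −i Tr(P g⁻ [h, g⁺ o
g⁺†] g⁻†) (`gradient_eq`). By `moment_formula`, Tr(P g x g†) with x traceless has mean zero and
second moment Tr x² / (n² − 1) · (Tr P² − (Tr P)²/n). Since σ_z has expectation 0 in |+⟩, P is
tridiagonal with entries 1/2 and 1/4, and the last factor is (n − 1)/8. Averaging Tr [h, x]² over
the orbit of o gives −2n Tr h² Tr o² / (n² − 1). These two averages, with (−i)² = −1, multiply to
the stated value. -/

namespace CompoundAnsatz

/-! ### Tensor products of one-qubit operators -/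

section TensorOp

variable {n : ℕ}

lemma tensorOp_apply (P : Fin n → Matrix (Fin 2) (Fin 2) ℂ) (x y : Bits n) :
    tensorOp P x y = ∏ k, P k (x k) (y k) := rfl

lemma tensorOp_mul (P Q : Fin n → Matrix (Fin 2) (Fin 2) ℂ) :
    tensorOp P * tensorOp Q = tensorOp fun k => P k * Q k := by
  ext x y
  simp only [tensorOp_apply, Matrix.mul_apply, Finset.prod_univ_sum, Fintype.piFinset_univ,
    Finset.prod_mul_distrib]

lemma tensorOp_one : tensorOp (fun _ : Fin n => 1) = 1 := by
  ext x y
  rw [tensorOp_apply, Matrix.one_apply]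
  split_ifs with h
  · subst h
    exact Finset.prod_eq_one fun k _ => Matrix.one_apply_eq _
  · obtain ⟨k, hk⟩ := Function.ne_iff.mp h
    exact Finset.prod_eq_zero (Finset.mem_univ k) (Matrix.one_apply_ne hk)

lemma tensorOp_conjTranspose (P : Fin n → Matrix (Fin 2) (Fin 2) ℂ) :
    (tensorOp P)ᴴ = tensorOp fun k => (P k)ᴴ := by
  ext x y
  simp [tensorOp_apply, Matrix.conjTranspose_apply]

lemma tensorOp_eq_zero {P : Fin n → Matrix (Fin 2) (Fin 2) ℂ} (i : Fin n) (h : P i = 0) :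
    tensorOp P = 0 := by
  ext x y
  exact Finset.prod_eq_zero (Finset.mem_univ i) (by simp [h])

/-- Multilinearity in slot `i`. The families are tied together by hypotheses rather than by
`Function.update`, so that families given by `if` expressions fit directly. -/
lemma tensorOp_add {P Q S : Fin n → Matrix (Fin 2) (Fin 2) ℂ} (i : Fin n)
    (hi : S i = P i + Q i) (hP : ∀ k, k ≠ i → P k = S k) (hQ : ∀ k, k ≠ i → Q k = S k) :
    tensorOp S = tensorOp P + tensorOp Q := by
  ext x y
  simp only [tensorOp_apply, Matrix.add_apply]
  rw [← Finset.mul_prod_erase _ _ (Finset.mem_univ i),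
    ← Finset.mul_prod_erase _ (fun k => P k (x k) (y k)) (Finset.mem_univ i),
    ← Finset.mul_prod_erase _ (fun k => Q k (x k) (y k)) (Finset.mem_univ i), hi]
  have h1 : ∏ k ∈ Finset.univ.erase i, P k (x k) (y k) =
      ∏ k ∈ Finset.univ.erase i, S k (x k) (y k) :=
    Finset.prod_congr rfl fun k hk => congrFun₂ (hP k (Finset.ne_of_mem_erase hk)) _ _
  have h2 : ∏ k ∈ Finset.univ.erase i, Q k (x k) (y k) =
      ∏ k ∈ Finset.univ.erase i, S k (x k) (y k) :=
    Finset.prod_congr rfl fun k hk => congrFun₂ (hQ k (Finset.ne_of_mem_erase hk)) _ _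
  rw [h1, h2, Matrix.add_apply, add_mul]

lemma tensorOp_smul {P S : Fin n → Matrix (Fin 2) (Fin 2) ℂ} (c : ℂ) (i : Fin n)
    (hi : S i = c • P i) (hP : ∀ k, k ≠ i → P k = S k) :
    tensorOp S = c • tensorOp P := by
  ext x y
  simp only [tensorOp_apply, Matrix.smul_apply]
  rw [← Finset.mul_prod_erase _ _ (Finset.mem_univ i),
    ← Finset.mul_prod_erase _ (fun k => P k (x k) (y k)) (Finset.mem_univ i), hi]
  have h1 : ∏ k ∈ Finset.univ.erase i, P k (x k) (y k) =
      ∏ k ∈ Finset.univ.erase i, S k (x k) (y k) :=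
    Finset.prod_congr rfl fun k hk => congrFun₂ (hP k (Finset.ne_of_mem_erase hk)) _ _
  rw [h1, Matrix.smul_apply, smul_mul_assoc]

lemma tensorOp_neg {P S : Fin n → Matrix (Fin 2) (Fin 2) ℂ} (i : Fin n)
    (hi : S i = -P i) (hP : ∀ k, k ≠ i → P k = S k) : tensorOp S = -tensorOp P := by
  rw [tensorOp_smul (-1) i (by simpa using hi) hP, neg_one_smul]

end TensorOp

/-! ### Jordan–Wigner creation and annihilation operators -/

/-- `|1⟩⟨0|`. -/
def raiseMat : Matrix (Fin 2) (Fin 2) ℂ := !![0, 0; 1, 0]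

/-- `|0⟩⟨1|`. -/
def lowerMat : Matrix (Fin 2) (Fin 2) ℂ := !![0, 1; 0, 0]

/-- The operator `σ_z ⊗ ⋯ ⊗ σ_z ⊗ A ⊗ 1 ⊗ ⋯ ⊗ 1` with `A` at position `i`. -/
def jordanWigner {n : ℕ} (A : Matrix (Fin 2) (Fin 2) ℂ) (i : Fin n) : QOp n :=
  tensorOp fun k => if k < i then σz else if k = i then A else 1

/-- The fermionic creation operator of mode `i`. -/
def cr {n : ℕ} (i : Fin n) : QOp n := jordanWigner raiseMat i

/-- The fermionic annihilation operator of mode `i`. -/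
def an {n : ℕ} (i : Fin n) : QOp n := jordanWigner lowerMat i

/-- The vacuum vector `|0 ⋯ 0⟩`. -/
def vac (n : ℕ) : Bits n → ℂ := Pi.single 0 1

lemma σz_mul_σz : σz * σz = 1 := by
  ext i j; fin_cases i <;> fin_cases j <;> simp [σz]

lemma σz_conjTranspose : σzᴴ = σz := by
  ext i j; fin_cases i <;> fin_cases j <;> simp [σz]

lemma raiseMat_conjTranspose : raiseMatᴴ = lowerMat := by
  ext i j; fin_cases i <;> fin_cases j <;> simp [raiseMat, lowerMat]

lemma raiseMat_mul_σz : raiseMat * σz = raiseMat := by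
  ext i j; fin_cases i <;> fin_cases j <;> simp [raiseMat, σz]

lemma σz_mul_raiseMat : σz * raiseMat = -raiseMat := by
  ext i j; fin_cases i <;> fin_cases j <;> simp [raiseMat, σz]

lemma lowerMat_mul_σz : lowerMat * σz = -lowerMat := by
  ext i j; fin_cases i <;> fin_cases j <;> simp [lowerMat, σz]

lemma σz_mul_lowerMat : σz * lowerMat = lowerMat := by
  ext i j; fin_cases i <;> fin_cases j <;> simp [lowerMat, σz]

lemma raiseMat_mul_raiseMat : raiseMat * raiseMat = 0 := by
  ext i j; fin_cases i <;> fin_cases j <;> simp [raiseMat]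

lemma anticomm_lower_raise : lowerMat * raiseMat + raiseMat * lowerMat = 1 := by
  ext i j; fin_cases i <;> fin_cases j <;> simp [lowerMat, raiseMat]

/-! ### Canonical anticommutation relations. -/

section CAR

variable {n : ℕ}

/-- Only slot `i` is sensitive to the order: there `A` meets one `σz` from the string of the later
operator, which produces the sign. -/
lemma jordanWigner_mul_of_lt {A B : Matrix (Fin 2) (Fin 2) ℂ} {i j : Fin n} (hij : i < j)
    (hA : σz * A = -(A * σz)) :
    jordanWigner A i * jordanWigner B j = -(jordanWigner B j * jordanWigner A i) := by
  simp only [jordanWigner, tensorOp_mul]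
  refine tensorOp_neg i ?_ ?_
  · simp [hij, hA]
  · intro k hk
    rcases lt_trichotomy k i with h | h | h
    · simp [h, h.trans hij]
    · exact absurd h hk
    · simp [h.not_gt, hk]

lemma jordanWigner_anticomm {A B : Matrix (Fin 2) (Fin 2) ℂ} {i j : Fin n} (hij : i ≠ j)
    (hA : σz * A = -(A * σz)) (hB : σz * B = -(B * σz)) :
    jordanWigner A i * jordanWigner B j = -(jordanWigner B j * jordanWigner A i) := by
  rcases lt_or_gt_of_ne hij with h | h
  · exact jordanWigner_mul_of_lt h hA
  · rw [jordanWigner_mul_of_lt h hB, neg_neg]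

lemma raiseMat_anticomm_σz : σz * raiseMat = -(raiseMat * σz) := by
  rw [σz_mul_raiseMat, raiseMat_mul_σz]

lemma lowerMat_anticomm_σz : σz * lowerMat = -(lowerMat * σz) := by
  rw [σz_mul_lowerMat, lowerMat_mul_σz, neg_neg]

lemma cr_mul_cr (i j : Fin n) : cr i * cr j = -(cr j * cr i) := by
  rcases eq_or_ne i j with rfl | h
  · have : cr i * cr i = 0 := by
      rw [cr, jordanWigner, tensorOp_mul]
      exact tensorOp_eq_zero i (by simp [raiseMat_mul_raiseMat])
    simp [this]
  · exact jordanWigner_anticomm h raiseMat_anticomm_σz raiseMat_anticomm_σz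

lemma an_mul_cr (i j : Fin n) :
    an i * cr j = (if i = j then 1 else 0) - cr j * an i := by
  split_ifs with h
  · subst h
    rw [eq_sub_iff_add_eq, an, cr, jordanWigner, jordanWigner, tensorOp_mul, tensorOp_mul,
      ← tensorOp_one]
    symm
    refine tensorOp_add i (by simp [anticomm_lower_raise]) ?_ ?_ <;>
    · intro k hk
      rcases lt_or_gt_of_ne hk with h | h
      · simp [h, σz_mul_σz]
      · simp [h.not_gt, hk]
  · rw [zero_sub]
    exact jordanWigner_anticomm h lowerMat_anticomm_σz raiseMat_anticomm_σz

lemma cr_conjTranspose (i : Fin n) : (cr i)ᴴ = an i := by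
  rw [cr, an, jordanWigner, jordanWigner, tensorOp_conjTranspose]
  congr 1
  funext k
  split_ifs <;> simp [σz_conjTranspose, raiseMat_conjTranspose]

/-- With no occupied site at or below `i`, the string acts by +1, so no sign appears. -/
lemma cr_mulVec_single (i : Fin n) (x : Bits n) (hx : ∀ k ≤ i, x k = 0) :
    cr i *ᵥ Pi.single x 1 = Pi.single (Function.update x i 1) 1 := by
  ext y
  rw [Matrix.mulVec_single_one, Matrix.col_apply, cr, jordanWigner, tensorOp_apply]
  by_cases h : y = Function.update x i 1
  · subst h
    rw [Pi.single_eq_same]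
    refine Finset.prod_eq_one fun k _ => ?_
    rcases lt_trichotomy k i with h | h | h
    · simp [h, h.ne, hx k h.le, σz]
    · subst h; simp [hx k le_rfl, raiseMat]
    · simp only [h.not_gt, h.ne', if_false, Function.update_of_ne h.ne']
      exact Matrix.one_apply_eq _
  · rw [Pi.single_eq_of_ne h]
    obtain ⟨k, hk⟩ := Function.ne_iff.mp h
    refine Finset.prod_eq_zero (Finset.mem_univ k) ?_
    rcases lt_trichotomy k i with h | h | h
    · rw [Function.update_of_ne h.ne, hx k h.le] at hk
      simp [h, hx k h.le, Fin.eq_one_of_ne_zero _ hk, σz]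
    · subst h
      rw [Function.update_self] at hk
      have : y k = 0 := by omega
      simp [this, hx k le_rfl, raiseMat]
    · rw [Function.update_of_ne h.ne'] at hk
      simp [h.not_gt, h.ne', hk]

lemma an_mulVec_vac (i : Fin n) : an i *ᵥ vac n = 0 := by
  ext y
  rw [vac, Matrix.mulVec_single_one, Matrix.col_apply, an, jordanWigner, tensorOp_apply]
  refine Finset.prod_eq_zero (Finset.mem_univ i) ?_
  rcases Fin.exists_fin_two.mp ⟨y i, rfl⟩ with h | h <;> simp [h, lowerMat]

/-- A vector annihilated by all annihilation operators is a multiple of the vacuum. -/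
lemma eq_smul_vac {v : Bits n → ℂ} (hv : ∀ i, an i *ᵥ v = 0) : v = v 0 • vac n := by
  ext x
  by_cases h : x = 0
  · simp [h, vac]
  obtain ⟨i, hi⟩ := Function.ne_iff.mp h
  have hi1 : x i = 1 := Fin.eq_one_of_ne_zero _ hi
  -- The number operator of an occupied site `i` is diagonal with entry 1 at `x`, while it kills
  -- `v`; hence `v x = 0`.
  have h0 : (cr i * an i) *ᵥ v = 0 := by rw [← Matrix.mulVec_mulVec, hv, Matrix.mulVec_zero]
  have h1 : ((cr i * an i) *ᵥ v) x = v x := by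
    rw [Matrix.mulVec, dotProduct, Finset.sum_eq_single x]
    · have : (cr i * an i) x x = 1 := by
        rw [cr, an, jordanWigner, jordanWigner, tensorOp_mul, tensorOp_apply]
        refine Finset.prod_eq_one fun k _ => ?_
        rcases lt_trichotomy k i with h | h | h
        · simp [h, σz_mul_σz]
        · subst h; simp [hi1, raiseMat, lowerMat]
        · simp [h.not_gt, h.ne']
      rw [this, one_mul]
    · intro y _ hy
      have : (cr i * an i) x y = 0 := by
        rw [cr, an, jordanWigner, jordanWigner, tensorOp_mul, tensorOp_apply]
        obtain ⟨k, hk⟩ := Function.ne_iff.mp hy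
        refine Finset.prod_eq_zero (Finset.mem_univ k) ?_
        rcases lt_trichotomy k i with h | h | h
        · simp [h, σz_mul_σz, hk.symm]
        · subst h
          have : y k = 0 := by omega
          simp [hi1, this, raiseMat, lowerMat]
        · simp [h.not_gt, h.ne', hk.symm]
      rw [this, zero_mul]
    · simp
  rw [← h1, h0]
  simp [vac, h]

/-- The creation operator of the single-particle state `v`. -/
noncomputable def crV : (Fin n → ℂ) →ₗ[ℂ] QOp n where
  toFun v := ∑ i, v i • cr i
  map_add' v w := by simp [add_smul, Finset.sum_add_distrib]
  map_smul' c v := by simp [mul_smul, Finset.smul_sum]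

lemma crV_apply (v : Fin n → ℂ) : crV v = ∑ i, v i • cr i := rfl

lemma crV_single (i : Fin n) : crV (Pi.single i 1) = cr i := by
  rw [crV_apply, Finset.sum_eq_single i] <;> simp +contextual

lemma crV_mul_crV (v w : Fin n → ℂ) : crV v * crV w = -(crV w * crV v) := by
  simp only [crV_apply, Finset.sum_mul_sum, smul_mul_smul_comm]
  rw [Finset.sum_comm, ← Finset.sum_neg_distrib]
  refine Finset.sum_congr rfl fun i _ => ?_
  rw [← Finset.sum_neg_distrib]
  refine Finset.sum_congr rfl fun j _ => ?_
  rw [cr_mul_cr, smul_neg, mul_comm]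

lemma crV_mul_self (v : Fin n → ℂ) : crV v * crV v = 0 := by
  have h := crV_mul_crV v v
  rw [eq_neg_iff_add_eq_zero, ← two_smul ℂ] at h
  exact (smul_eq_zero.mp h).resolve_left two_ne_zero

lemma an_mul_crV (i : Fin n) (v : Fin n → ℂ) :
    an i * crV v = v i • (1 : QOp n) - crV v * an i := by
  simp only [crV_apply, Finset.mul_sum, Finset.sum_mul, mul_smul_comm, smul_mul_assoc, an_mul_cr,
    smul_sub, Finset.sum_sub_distrib]
  simp

end CAR

/-! ### The exterior algebra in occupation-number coordinates -/

section Fock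

variable {n : ℕ}

/-- In increasing order the largest index acts first, so each creation operator finds all sites up
to its own empty. -/
lemma prod_map_cr_mulVec_vac (l : List (Fin n)) (hl : l.Pairwise (· < ·)) :
    (l.map cr).prod *ᵥ vac n = Pi.single ((bitsEquivFinset n).symm l.toFinset) 1 := by
  induction l with
  | nil =>
    rw [List.map_nil, List.prod_nil, Matrix.one_mulVec, vac]
    congr 1
  | cons i l ih =>
    rw [List.pairwise_cons] at hl
    rw [List.map_cons, List.prod_cons, ← Matrix.mulVec_mulVec, ih hl.2, cr_mulVec_single]
    · congr 1
      funext k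
      rcases eq_or_ne k i with rfl | h
      · simp [bitsEquivFinset]
      · simp [bitsEquivFinset, h]
    · intro k hk
      have : k ∉ l := fun h => (hl.1 k h).not_ge hk
      simp [bitsEquivFinset, this]

/-- The action of the exterior algebra on the `n`-qubit space by creation operators. -/
noncomputable def fockRep (n : ℕ) : ExteriorAlgebra ℂ (Fin n → ℂ) →ₐ[ℂ] QOp n :=
  ExteriorAlgebra.lift ℂ ⟨crV, crV_mul_self⟩

lemma fockRep_ι (v : Fin n → ℂ) : fockRep n (ExteriorAlgebra.ι ℂ v) = crV v :=
  ExteriorAlgebra.lift_ι_apply _ _ _ _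

lemma fockRep_wedgeBasis_mulVec_vac (x : Bits n) :
    fockRep n (wedgeBasis n x) *ᵥ vac n = Pi.single x 1 := by
  set s : Finset (Fin n) := (bitsEquivFinset n).symm.symm x 
  have hb : wedgeBasis n x = (List.ofFn fun i =>
      ExteriorAlgebra.ι ℂ (Pi.single (s.orderEmbOfFin rfl i) (1 : ℂ))).prod := by
    rw [wedgeBasis, Module.Basis.reindex_apply, ExteriorAlgebra.basis_apply_ofCard _ (rfl : s.card = _),
      ExteriorAlgebra.ιMulti_family, ExteriorAlgebra.ιMulti_apply]
    simp [Set.powersetCard.ofFinEmbEquiv_symm_apply]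
  have h : (fockRep n ∘ fun i => ExteriorAlgebra.ι ℂ (Pi.single (s.orderEmbOfFin rfl i) (1 : ℂ))) =
      cr ∘ s.orderEmbOfFin rfl := by
    funext i
    rw [Function.comp_apply, fockRep_ι, crV_single, Function.comp_apply]
  rw [hb, map_list_prod, List.map_ofFn]
  rw [h, ← List.map_ofFn, prod_map_cr_mulVec_vac]
  · congr 1
    rw [Equiv.symm_apply_eq]
    ext k
    rw [List.mem_toFinset, List.mem_ofFn]
    change k ∈ Set.range (s.orderEmbOfFin rfl) ↔ _
    rw [Finset.range_orderEmbOfFin s rfl]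
    rfl
  · exact List.pairwise_ofFn.mpr fun a b hab => (s.orderEmbOfFin rfl).strictMono hab

/-- Coordinates with respect to `wedgeBasis` are obtained by acting on the vacuum. -/
lemma equivFun_wedgeBasis (w : ExteriorAlgebra ℂ (Fin n → ℂ)) :
    (wedgeBasis n).equivFun w = fockRep n w *ᵥ vac n := by
  have : (wedgeBasis n).equivFun.toLinearMap =
      (LinearMap.flip (Matrix.mulVecBilin ℂ ℂ) (vac n)) ∘ₗ (fockRep n).toLinearMap := by
    refine (wedgeBasis n).ext fun x => ?_
    simp only [LinearMap.comp_apply, LinearMap.flip_apply, AlgHom.toLinearMap_apply,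
      Matrix.mulVecBilin_apply, fockRep_wedgeBasis_mulVec_vac, LinearEquiv.coe_coe]
    ext y
    simp [Module.Basis.equivFun_self, Pi.single_apply, eq_comm]
  exact LinearMap.congr_fun this w

lemma compound_mulVec (g : Matrix (Fin n) (Fin n) ℂ) (w : ExteriorAlgebra ℂ (Fin n → ℂ)) :
    compound g *ᵥ (fockRep n w *ᵥ vac n) =
      fockRep n (ExteriorAlgebra.map (Matrix.toLin' g) w) *ᵥ vac n := by
  rw [← equivFun_wedgeBasis, ← equivFun_wedgeBasis]
  exact LinearMap.toMatrix_mulVec_repr (wedgeBasis n) (wedgeBasis n) _ w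

lemma exists_fockRep (v : Bits n → ℂ) : ∃ w, fockRep n w *ᵥ vac n = v :=
  ⟨(wedgeBasis n).equivFun.symm v, by rw [← equivFun_wedgeBasis, LinearEquiv.apply_symm_apply]⟩

/-- The vacuum is cyclic for the creation operators. -/
lemma fock_induction {p : (Bits n → ℂ) → Prop} (h0 : p (vac n))
    (hadd : ∀ v w, p v → p w → p (v + w)) (hsmul : ∀ (c : ℂ) v, p v → p (c • v))
    (hcr : ∀ v i, p v → p (cr i *ᵥ v)) (v : Bits n → ℂ) : p v := by
  have hs (x : Bits n) : p (Pi.single x 1) := by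
    have h := prod_map_cr_mulVec_vac (((bitsEquivFinset n x).sort (· ≤ ·)))
      (Finset.sortedLT_sort _).pairwise
    rw [Finset.sort_toFinset, Equiv.symm_apply_apply] at h
    rw [← h]
    -- Closure of `p` under `cr` is blind to the order of the list, so sortedness is dropped before
    -- the induction.
    generalize ((bitsEquivFinset n x).sort (· ≤ ·)) = l
    clear h
    induction l with
    | nil => simpa using h0
    | cons i l ih => simpa [← Matrix.mulVec_mulVec] using hcr _ i ih
  have hz : p 0 := by simpa using hsmul 0 _ h0
  rw [pi_eq_sum_univ' v]
  refine Finset.sum_induction _ p (fun a b => hadd a b) hz fun x _ => ?_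
  have := hsmul (v x) _ (hs x)
  convert this using 2

/-- Uniqueness principle: by cyclicity of the vacuum, its image and the exchange rule with creation
operators determine an operator. -/
lemma matrix_eq_of_commute_cr {A B : QOp n} (C : Fin n → QOp n)
    (h0 : A *ᵥ vac n = B *ᵥ vac n)
    (hA : ∀ i, A * cr i = C i * A) (hB : ∀ i, B * cr i = C i * B) : A = B := by
  refine Matrix.ext_of_mulVec_single fun x => ?_
  refine fock_induction (p := fun v => A *ᵥ v = B *ᵥ v) h0 ?_ ?_ ?_ _
  · intro v w hv hw; simp [Matrix.mulVec_add, hv, hw]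
  · intro c v hv; simp [Matrix.mulVec_smul, hv]
  · intro v i hv
    rw [Matrix.mulVec_mulVec, Matrix.mulVec_mulVec, hA, hB, ← Matrix.mulVec_mulVec, hv,
      Matrix.mulVec_mulVec]

end Fock

/-! ### The compound representation -/

section Compound

variable {n : ℕ}

lemma compound_mulVec_vac (g : Matrix (Fin n) (Fin n) ℂ) : compound g *ᵥ vac n = vac n := by
  simpa using compound_mulVec g 1

/-- This is multiplicativity of ⋀g, namely ⋀g (v ∧ w) = gv ∧ ⋀g w, read in Fock coordinates. -/
lemma compound_mul_crV (g : Matrix (Fin n) (Fin n) ℂ) (v : Fin n → ℂ) :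
    compound g * crV v = crV (g *ᵥ v) * compound g := by
  refine Matrix.ext_of_mulVec_single fun x => ?_
  obtain ⟨w, hw⟩ := exists_fockRep (Pi.single x (1 : ℂ))
  rw [← hw, ← Matrix.mulVec_mulVec, ← Matrix.mulVec_mulVec, compound_mulVec,
    Matrix.mulVec_mulVec _ (crV v), ← fockRep_ι v, ← map_mul,
    compound_mulVec, map_mul, ExteriorAlgebra.map_apply_ι, map_mul, fockRep_ι, Matrix.toLin'_apply,
    Matrix.mulVec_mulVec]

lemma compound_mul_cr (g : Matrix (Fin n) (Fin n) ℂ) (i : Fin n) :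
    compound g * cr i = crV (g.col i) * compound g := by
  rw [← crV_single, compound_mul_crV, Matrix.mulVec_single_one]

lemma eq_compound {g : Matrix (Fin n) (Fin n) ℂ} {U : QOp n} (h0 : U *ᵥ vac n = vac n)
    (h : ∀ i, U * cr i = crV (g.col i) * U) : U = compound g :=
  matrix_eq_of_commute_cr (fun i => crV (g.col i)) (by rw [h0, compound_mulVec_vac]) h
    (compound_mul_cr g)

lemma compound_one : compound (1 : Matrix (Fin n) (Fin n) ℂ) = 1 := by
  symm
  refine eq_compound (by simp) fun i => ?_
  have : (1 : Matrix (Fin n) (Fin n) ℂ).col i = Pi.single i 1 := by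
    rw [← Matrix.mulVec_single_one, Matrix.one_mulVec]
  rw [this, crV_single, one_mul, mul_one]

lemma compound_mul (g h : Matrix (Fin n) (Fin n) ℂ) :
    compound (g * h) = compound g * compound h := by
  symm
  refine eq_compound ?_ fun i => ?_
  · rw [← Matrix.mulVec_mulVec, compound_mulVec_vac, compound_mulVec_vac]
  · rw [mul_assoc, compound_mul_cr, ← mul_assoc, compound_mul_crV, mul_assoc,
      ← Matrix.mulVec_single_one, ← Matrix.mulVec_single_one, Matrix.mulVec_mulVec]

/-- The annihilation operator dual to `crV v`. -/
lemma crV_conjTranspose (v : Fin n → ℂ) : (crV v)ᴴ = ∑ i, star (v i) • an i := by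
  simp [crV_apply, Matrix.conjTranspose_sum, cr_conjTranspose]

lemma conjTranspose_crV_mul_crV (w v : Fin n → ℂ) :
    (crV w)ᴴ * crV v = (star w ⬝ᵥ v) • (1 : QOp n) - crV v * (crV w)ᴴ := by
  simp only [crV_conjTranspose, Finset.sum_mul, smul_mul_assoc, an_mul_crV, Finset.mul_sum,
    mul_smul_comm, smul_sub, Finset.sum_sub_distrib, dotProduct, Finset.sum_smul, smul_smul,
    Pi.star_apply]

lemma conjTranspose_crV_mulVec_vac (w : Fin n → ℂ) : (crV w)ᴴ *ᵥ vac n = 0 := by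
  simp [crV_conjTranspose, Matrix.sum_mulVec, Matrix.smul_mulVec, an_mulVec_vac]

/-- Induction on the number of particles. Unitarity enters because moving an annihilator past a
creator leaves the inner product ⟨w, v⟩, which `g` must preserve. -/
lemma compound_mul_conjTranspose_crV {g : Matrix (Fin n) (Fin n) ℂ} (hg : gᴴ * g = 1)
    (w : Fin n → ℂ) : compound g * (crV w)ᴴ = (crV (g *ᵥ w))ᴴ * compound g := by
  refine Matrix.ext_of_mulVec_single fun x => ?_
  refine fock_induction (p := fun v => (compound g * (crV w)ᴴ) *ᵥ v =
    ((crV (g *ᵥ w))ᴴ * compound g) *ᵥ v) ?_ ?_ ?_ ?_ _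
  · rw [← Matrix.mulVec_mulVec, ← Matrix.mulVec_mulVec, compound_mulVec_vac,
      conjTranspose_crV_mulVec_vac, conjTranspose_crV_mulVec_vac, Matrix.mulVec_zero]
  · intro v w hv hw; simp only [Matrix.mulVec_add, hv, hw]
  · intro c v hv; simp only [Matrix.mulVec_smul, hv]
  · intro v i hv
    have hd : star (g *ᵥ w) ⬝ᵥ (g *ᵥ Pi.single i 1) = star w ⬝ᵥ Pi.single i 1 := by
      rw [Matrix.star_mulVec, ← Matrix.dotProduct_mulVec, Matrix.mulVec_mulVec, hg,
        Matrix.one_mulVec]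
    rw [Matrix.mulVec_mulVec, Matrix.mulVec_mulVec, ← crV_single, mul_assoc, mul_assoc,
      conjTranspose_crV_mul_crV, compound_mul_crV, ← mul_assoc _ (crV (g *ᵥ Pi.single i 1)),
      conjTranspose_crV_mul_crV, hd, mul_sub, sub_mul, ← mul_assoc, compound_mul_crV,
      Matrix.sub_mulVec, Matrix.sub_mulVec, mul_assoc, mul_assoc, ← Matrix.mulVec_mulVec v (crV _),
      hv, Matrix.mulVec_mulVec]
    simp

/-- The adjoint meets the characterization `eq_compound`: its exchange rule is the adjoint of the
previous lemma, and its value on the vacuum is killed by every annihilator, hence a multiple of the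
vacuum with coefficient 1. -/
lemma compound_conjTranspose {g : Matrix (Fin n) (Fin n) ℂ} (hg : gᴴ * g = 1) :
    (compound g)ᴴ = compound gᴴ := by
  have hg' : g * gᴴ = 1 := mul_eq_one_comm.mp hg
  have hcr (v : Fin n → ℂ) : (compound g)ᴴ * crV v = crV (gᴴ *ᵥ v) * (compound g)ᴴ := by
    have := congrArg Matrix.conjTranspose (compound_mul_conjTranspose_crV hg (gᴴ *ᵥ v))
    rw [Matrix.mulVec_mulVec, hg', Matrix.one_mulVec] at this
    simpa [Matrix.conjTranspose_mul] using this.symm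
  refine eq_compound ?_ fun i => by rw [← crV_single, hcr, Matrix.mulVec_single_one]
  have h0 : (compound g)ᴴ *ᵥ vac n = ((compound g)ᴴ *ᵥ vac n) 0 • vac n := by
    refine eq_smul_vac fun i => ?_
    have := congrArg Matrix.conjTranspose (compound_mul_cr g i)
    rw [Matrix.conjTranspose_mul, Matrix.conjTranspose_mul, cr_conjTranspose] at this
    rw [Matrix.mulVec_mulVec, this, ← Matrix.mulVec_mulVec, conjTranspose_crV_mulVec_vac,
      Matrix.mulVec_zero]
  have h1 : ((compound g)ᴴ *ᵥ vac n) 0 = 1 := by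
    have := congrFun (compound_mulVec_vac g) 0
    rw [vac, Matrix.mulVec_single_one, Pi.single_eq_same] at this
    rw [vac, Matrix.mulVec_single_one, Matrix.col_apply, Matrix.conjTranspose_apply]
    rw [Matrix.col_apply] at this
    simp [this]
  rw [h0, h1, one_smul]

end Compound

/-! ### Second quantization, the differential of the compound representation -/

section SecondQuantization

variable {n : ℕ}

/-- The one-body operator `∑ a i j • (cr i * an j)`. -/
noncomputable def oneBody : Matrix (Fin n) (Fin n) ℂ →ₗ[ℂ] QOp n where
  toFun a := ∑ j, crV (a.col j) * an j
  map_add' a b := by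
    rw [← Finset.sum_add_distrib]
    refine Finset.sum_congr rfl fun j _ => ?_
    rw [← add_mul, ← map_add]
    rfl
  map_smul' c a := by
    rw [Finset.smul_sum]
    refine Finset.sum_congr rfl fun j _ => ?_
    rw [RingHom.id_apply, ← smul_mul_assoc, ← map_smul]
    rfl

lemma oneBody_apply (a : Matrix (Fin n) (Fin n) ℂ) : oneBody a = ∑ j, crV (a.col j) * an j := rfl

lemma oneBody_single (i j : Fin n) (c : ℂ) :
    oneBody (Matrix.single i j c) = c • (cr i * an j) := by
  rw [oneBody_apply, Finset.sum_eq_single j]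
  · rw [← smul_mul_assoc, ← crV_single i, ← map_smul]
    congr 2
    ext k
    simp [Matrix.single_apply, Pi.single_apply, eq_comm]
  · intro k _ hk
    have : (Matrix.single i j c).col k = 0 := by
      ext l
      simp [hk.symm]
    rw [this, map_zero, zero_mul]
  · simp

lemma oneBody_eq_sum (a : Matrix (Fin n) (Fin n) ℂ) :
    oneBody a = ∑ i, ∑ j, a i j • (cr i * an j) := by
  conv_lhs => rw [Matrix.matrix_eq_sum_single a]
  simp only [map_sum, oneBody_single]

lemma oneBody_mulVec_vac (a : Matrix (Fin n) (Fin n) ℂ) : oneBody a *ᵥ vac n = 0 := by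
  simp only [oneBody_apply, Matrix.sum_mulVec, ← Matrix.mulVec_mulVec, an_mulVec_vac,
    Matrix.mulVec_zero, Finset.sum_const_zero]

/-- A one-body operator acts as a derivation: [dΓ(a), a†(v)] = a†(av). -/
lemma oneBody_mul_crV (a : Matrix (Fin n) (Fin n) ℂ) (v : Fin n → ℂ) :
    oneBody a * crV v = crV (a *ᵥ v) + crV v * oneBody a := by
  have h (j : Fin n) : crV (a.col j) * an j * crV v =
      crV (v j • a.col j) + crV v * (crV (a.col j) * an j) := by
    rw [mul_assoc, an_mul_crV, mul_sub, mul_smul_comm, mul_one, ← mul_assoc, crV_mul_crV, map_smul,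
      neg_mul, sub_neg_eq_add, mul_assoc]
  rw [oneBody_apply, Finset.sum_mul, Finset.sum_congr rfl fun j _ => h j, Finset.sum_add_distrib,
    Finset.mul_sum, ← map_sum]
  congr 2
  ext k
  simp [Matrix.mulVec, dotProduct, mul_comm]

lemma oneBody_mul_cr (a : Matrix (Fin n) (Fin n) ℂ) (i : Fin n) :
    oneBody a * cr i = crV (a.col i) + cr i * oneBody a := by
  rw [← crV_single, oneBody_mul_crV, Matrix.mulVec_single_one]

open scoped ComplexOrder in
lemma eq_zero_of_crV_mulVec_vac {w : Fin n → ℂ} (h : crV w *ᵥ vac n = 0) : w = 0 := by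
  have h1 : ((crV w)ᴴ * crV w) *ᵥ vac n = (star w ⬝ᵥ w) • vac n := by
    rw [conjTranspose_crV_mul_crV, Matrix.sub_mulVec, ← Matrix.mulVec_mulVec,
      conjTranspose_crV_mulVec_vac, Matrix.mulVec_zero, sub_zero, Matrix.smul_mulVec,
      Matrix.one_mulVec]
  rw [← Matrix.mulVec_mulVec, h, Matrix.mulVec_zero] at h1
  have h2 := congrFun h1 0
  simp only [vac, Pi.smul_apply, Pi.zero_apply, Pi.single_eq_same, smul_eq_mul, mul_one] at h2
  exact dotProduct_star_self_eq_zero.mp h2.symm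

/-- The action on one-particle states recovers the columns of `a`. -/
lemma oneBody_injective : Function.Injective (oneBody (n := n)) := by
  refine (injective_iff_map_eq_zero _).mpr fun a ha => ?_
  ext i j
  have h := congrArg (· *ᵥ vac n) (oneBody_mul_cr a j)
  simp only [ha, zero_mul, mul_zero, add_zero, Matrix.zero_mulVec] at h
  exact congrFun (eq_zero_of_crV_mulVec_vac h.symm) i

/-- The difference of the two sides kills the vacuum and commutes with every `cr i`, so it vanishes.
-/
lemma oneBody_lie (a b : Matrix (Fin n) (Fin n) ℂ) : ⁅oneBody a, oneBody b⁆ = oneBody ⁅a, b⁆ := by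
  rw [← sub_eq_zero]
  refine matrix_eq_of_commute_cr cr ?_ (fun i => ?_) (fun i => by simp)
  · simp only [Ring.lie_def, Matrix.sub_mulVec, ← Matrix.mulVec_mulVec, oneBody_mulVec_vac,
      Matrix.mulVec_zero, Matrix.zero_mulVec, sub_zero]
  · have hab (a b : Matrix (Fin n) (Fin n) ℂ) : oneBody a * oneBody b * cr i =
        crV (a *ᵥ b.col i) + crV (b.col i) * oneBody a + crV (a.col i) * oneBody b +
          cr i * (oneBody a * oneBody b) := by
      rw [mul_assoc, oneBody_mul_cr, mul_add, ← mul_assoc, oneBody_mul_cr, oneBody_mul_crV]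
      noncomm_ring
    have hc : crV (⁅a, b⁆.col i) = crV (a *ᵥ b.col i) - crV (b *ᵥ a.col i) := by
      rw [← map_sub, ← Matrix.mulVec_single_one, ← Matrix.mulVec_single_one,
        ← Matrix.mulVec_single_one, Matrix.mulVec_mulVec, Matrix.mulVec_mulVec,
        ← Matrix.sub_mulVec, Ring.lie_def]
    rw [Ring.lie_def, sub_mul, sub_mul, hab, hab, oneBody_mul_cr, hc]
    noncomm_ring

lemma compound_mul_oneBody {g : Matrix (Fin n) (Fin n) ℂ} (hg : gᴴ * g = 1)
    (a : Matrix (Fin n) (Fin n) ℂ) :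
    compound g * oneBody a = oneBody (g * a * gᴴ) * compound g := by
  have h (j : Fin n) : compound g * (crV (a.col j) * an j) =
      crV ((g * a).col j) * (crV (g.col j))ᴴ * compound g := by
    rw [← mul_assoc, compound_mul_crV, mul_assoc, ← cr_conjTranspose, ← crV_single j,
      compound_mul_conjTranspose_crV hg, Matrix.mulVec_single_one, mul_assoc,
      ← Matrix.mulVec_single_one, Matrix.mulVec_mulVec, Matrix.mulVec_single_one]
  rw [oneBody_apply, Finset.mul_sum, Finset.sum_congr rfl fun j _ => h j, ← Finset.sum_mul]
  congr 1
  simp only [crV_conjTranspose, Finset.mul_sum, mul_smul_comm]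
  rw [Finset.sum_comm, oneBody_apply]
  refine Finset.sum_congr rfl fun k _ => ?_
  simp only [← smul_mul_assoc, ← map_smul, ← Finset.sum_mul, ← map_sum]
  congr 2
  ext l
  simp [Matrix.mul_apply (M := g * a), mul_comm]

lemma compound_conj_oneBody {g : Matrix (Fin n) (Fin n) ℂ} (hg : gᴴ * g = 1)
    (a : Matrix (Fin n) (Fin n) ℂ) :
    compound g * oneBody a * (compound g)ᴴ = oneBody (g * a * gᴴ) := by
  rw [compound_mul_oneBody hg, mul_assoc, compound_conjTranspose hg, ← compound_mul,
    mul_eq_one_comm.mp hg, compound_one, mul_one]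

/-! ### Differentiating the compound representation along one-parameter groups. -/

section Deriv

attribute [local instance] Matrix.linftyOpNormedRing Matrix.linftyOpNormedAlgebra

lemma hasDerivAt_exp_smul_apply (a : Matrix (Fin n) (Fin n) ℂ) (i j : Fin n) :
    HasDerivAt (fun t : ℝ => (NormedSpace.exp (t • a) : Matrix (Fin n) (Fin n) ℂ) i j) (a i j) 0 := by
  have h := hasDerivAt_exp_smul_const a (0 : ℝ)
  rw [zero_smul, NormedSpace.exp_zero, one_mul] at h
  exact hasDerivAt_pi.mp (hasDerivAt_pi.mp h i) j

end Deriv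

/-- Fock induction avoids differentiating minors: the vacuum is fixed, and the product rule applied
to a†(exp(ta) e_i) · `compound` reproduces the exchange rule `oneBody_mul_cr`. -/
lemma hasDerivAt_compound_exp_mulVec (a : Matrix (Fin n) (Fin n) ℂ) (v : Bits n → ℂ) :
    HasDerivAt (fun t : ℝ => compound (NormedSpace.exp (t • a)) *ᵥ v) (oneBody a *ᵥ v) 0 := by
  refine fock_induction (p := fun v => HasDerivAt
    (fun t : ℝ => compound (NormedSpace.exp (t • a)) *ᵥ v) (oneBody a *ᵥ v) 0) ?_ ?_ ?_ ?_ v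
  · simp only [compound_mulVec_vac, oneBody_mulVec_vac]
    exact hasDerivAt_const _ _
  · intro v w hv hw
    simp only [Matrix.mulVec_add]
    exact hv.add hw
  · intro c v hv
    simp only [Matrix.mulVec_smul]
    exact hv.const_smul c
  · intro v i hv
    simp only [Matrix.mulVec_mulVec, compound_mul_cr, oneBody_mul_cr]
    have h1 : ∀ w : Fin n → ℂ, ∀ A : QOp n,
        (crV w * A) *ᵥ v = ∑ k, w k • (cr k *ᵥ (A *ᵥ v)) := by
      intro w A
      rw [← Matrix.mulVec_mulVec, crV_apply, Matrix.sum_mulVec]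
      simp only [Matrix.smul_mulVec]
    simp only [h1, Matrix.col_apply]
    have h2 (k : Fin n) : HasDerivAt
        (fun t : ℝ => cr k *ᵥ (compound (NormedSpace.exp (t • a)) *ᵥ v))
        (cr k *ᵥ (oneBody a *ᵥ v)) 0 :=
      ((Matrix.mulVecLin (cr k)).toContinuousLinearMap.restrictScalars ℝ).hasFDerivAt.comp_hasDerivAt
        (0 : ℝ) hv
    have h3 := HasDerivAt.fun_sum fun k (_ : k ∈ Finset.univ) =>
      (hasDerivAt_exp_smul_apply a k i).smul (h2 k)
    have h4 : (crV (a.col i) + cr i * oneBody a) *ᵥ v = ∑ k,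
        ((NormedSpace.exp ((0 : ℝ) • a) : Matrix (Fin n) (Fin n) ℂ) k i • cr k *ᵥ oneBody a *ᵥ v +
        a k i • cr k *ᵥ compound (NormedSpace.exp ((0 : ℝ) • a)) *ᵥ v) := by
      simp only [zero_smul, NormedSpace.exp_zero, compound_one, Matrix.one_mulVec]
      rw [Finset.sum_add_distrib, Matrix.add_mulVec, crV_apply, Matrix.sum_mulVec, add_comm]
      congr 1
      · rw [Finset.sum_eq_single i] <;> simp +contextual
      · simp [Matrix.smul_mulVec]
    rw [h4]
    exact h3

lemma dcompound_eq_oneBody (a : Matrix (Fin n) (Fin n) ℂ) : dcompound a = oneBody a := by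
  ext x y
  have h := hasDerivAt_pi.mp (hasDerivAt_compound_exp_mulVec a (Pi.single y 1)) x
  simp only [Matrix.mulVec_single_one, Matrix.col_apply] at h
  exact h.deriv

end SecondQuantization

/-! ### The generators as one-body operators -/

section Generators

variable {n : ℕ}

lemma pauliString_swap (A B : Matrix (Fin 2) (Fin 2) ℂ) {i j : Fin n} (hij : i ≠ j) :
    pauliString A B i j = pauliString B A j i := by
  unfold pauliString
  congr 1
  funext k
  rw [min_comm, max_comm]
  by_cases h1 : k = i
  · simp [h1, hij]
  · simp [h1]

lemma pauliString_add_left (A A' B : Matrix (Fin 2) (Fin 2) ℂ) (i j : Fin n) :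
    pauliString (A + A') B i j = pauliString A B i j + pauliString A' B i j :=
  tensorOp_add i (by simp) (fun k hk => by simp [hk]) (fun k hk => by simp [hk])

lemma pauliString_smul_left (c : ℂ) (A B : Matrix (Fin 2) (Fin 2) ℂ) (i j : Fin n) :
    pauliString (c • A) B i j = c • pauliString A B i j :=
  tensorOp_smul c i (by simp) (fun k hk => by simp [hk])

lemma pauliString_add_right (A B B' : Matrix (Fin 2) (Fin 2) ℂ) {i j : Fin n} (hij : i ≠ j) :
    pauliString A (B + B') i j = pauliString A B i j + pauliString A B' i j := by
  simp only [pauliString_swap A _ hij, pauliString_add_left]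

lemma pauliString_smul_right (c : ℂ) (A B : Matrix (Fin 2) (Fin 2) ℂ) {i j : Fin n} (hij : i ≠ j) :
    pauliString A (c • B) i j = c • pauliString A B i j := by
  simp only [pauliString_swap A _ hij, pauliString_smul_left]

/-- Strings cancel below both sites and survive between them. At the lower site the extra `σz` is
absorbed with sign +1 in either order, by `raiseMat_mul_σz` or `σz_mul_lowerMat`. -/
lemma cr_mul_an {i j : Fin n} (hij : i ≠ j) :
    cr i * an j = pauliString raiseMat lowerMat i j := by
  rw [cr, an, jordanWigner, jordanWigner, tensorOp_mul, pauliString]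
  congr 1
  funext k
  rcases lt_or_gt_of_ne hij with h | h
  · rw [min_eq_left h.le, max_eq_right h.le]
    rcases lt_trichotomy k i with hk | rfl | hk
    · simp [hk, hk.trans h, hk.ne, (hk.trans h).ne, hk.not_gt, σz_mul_σz]
    · simp [h, raiseMat_mul_σz]
    · simp [hk, hk.not_gt, hk.ne']
      rcases lt_trichotomy k j with hj | rfl | hj
      · simp [hj, hj.ne]
      · simp
      · simp [hj.not_gt, hj.ne']
  · rw [min_eq_right h.le, max_eq_left h.le]
    rcases lt_trichotomy k j with hk | rfl | hk
    · simp [hk, hk.trans h, hk.ne, (hk.trans h).ne, hk.not_gt, σz_mul_σz]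
    · simp [h, h.ne, σz_mul_lowerMat]
    · simp [hk, hk.not_gt, hk.ne']
      rcases lt_trichotomy k i with hj | rfl | hj
      · simp [hj, hj.ne]
      · simp
      · simp [hj.not_gt, hj.ne']

lemma σx_eq : σx = raiseMat + lowerMat := by
  ext i j; fin_cases i <;> fin_cases j <;> simp [raiseMat, lowerMat, σx]

lemma σy_eq : σy = Complex.I • raiseMat + (-Complex.I) • lowerMat := by
  ext i j; fin_cases i <;> fin_cases j <;> simp [raiseMat, lowerMat, σy]

/-- The preimage of `genX i j` in `su(n)`. -/
noncomputable def suX (i j : Fin n) : Matrix (Fin n) (Fin n) ℂ :=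
  Matrix.single i j (-(Complex.I / 2)) + Matrix.single j i (-(Complex.I / 2))

/-- The preimage of `genY i j` in `su(n)`. -/
noncomputable def suY (i j : Fin n) : Matrix (Fin n) (Fin n) ℂ :=
  Matrix.single i j (1 / 2) - Matrix.single j i (1 / 2)

/-- The preimage of `genZ i j` in `su(n)`. -/
noncomputable def suZ (i j : Fin n) : Matrix (Fin n) (Fin n) ℂ :=
  Matrix.single i i (Complex.I / 2) - Matrix.single j j (Complex.I / 2)

/-- In σxσx + σyσy the double raising and double lowering terms cancel, leaving twice the hopping
terms. -/
lemma oneBody_suX {i j : Fin n} (hij : i ≠ j) : oneBody (suX i j) = genX i j := by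
  rw [suX, map_add, oneBody_single, oneBody_single, cr_mul_an hij, cr_mul_an hij.symm,
    ← pauliString_swap lowerMat raiseMat hij, genX, σx_eq, σy_eq]
  simp only [pauliString_add_left, pauliString_add_right _ _ _ hij, pauliString_smul_left,
    pauliString_smul_right _ _ _ hij]
  match_scalars <;> ring_nf <;> simp only [Complex.I_pow_three] <;> ring

lemma oneBody_suY {i j : Fin n} (hij : i ≠ j) : oneBody (suY i j) = genY i j := by
  rw [suY, map_sub, oneBody_single, oneBody_single, cr_mul_an hij, cr_mul_an hij.symm,
    ← pauliString_swap lowerMat raiseMat hij, genY, σx_eq, σy_eq]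
  simp only [pauliString_add_left, pauliString_add_right _ _ _ hij, pauliString_smul_left,
    pauliString_smul_right _ _ _ hij]
  match_scalars <;> ring_nf
  all_goals simp only [Complex.I_sq]; ring

lemma onQubit_σz (i : Fin n) : onQubit σz i = 1 - (2 : ℂ) • (cr i * an i) := by
  rw [eq_sub_iff_add_eq, cr, an, jordanWigner, jordanWigner, tensorOp_mul, onQubit,
    ← tensorOp_one]
  have : (2 : ℂ) • tensorOp (fun k : Fin n => (if k < i then σz else if k = i then raiseMat else 1) *
      (if k < i then σz else if k = i then lowerMat else 1)) =
      tensorOp fun k => if k = i then (2 : ℂ) • (raiseMat * lowerMat) else 1 := by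
    symm
    refine tensorOp_smul 2 i (by simp) fun k hk => ?_
    rcases lt_or_gt_of_ne hk with h | h
    · simp [h, hk, σz_mul_σz]
    · simp [h.not_gt, hk]
  rw [this]
  symm
  refine tensorOp_add i ?_ (fun k hk => by simp [hk]) (fun k hk => by simp [hk])
  ext a b
  fin_cases a <;> fin_cases b <;> simp [σz, raiseMat, lowerMat]; norm_num

lemma oneBody_suZ (i j : Fin n) : oneBody (suZ i j) = genZ i j := by
  rw [suZ, map_sub, oneBody_single, oneBody_single, genZ, onQubit_σz, onQubit_σz]
  module

lemma suX_mem (i j : Fin n) (hij : i ≠ j) : suX i j ∈ su n := by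
  refine ⟨?_, ?_⟩
  · simp [suX, Matrix.conjTranspose_add, Matrix.conjTranspose_single, add_comm,
      ← Matrix.single_neg, div_eq_mul_inv]
  · simp [suX, Matrix.trace_add, Matrix.trace_single_eq_of_ne, hij, hij.symm]

lemma suY_mem (i j : Fin n) (hij : i ≠ j) : suY i j ∈ su n := by
  refine ⟨?_, ?_⟩
  · simp [suY, Matrix.conjTranspose_sub, Matrix.conjTranspose_single]
  · simp [suY, Matrix.trace_sub, Matrix.trace_single_eq_of_ne, hij, hij.symm]

lemma suZ_mem (i j : Fin n) : suZ i j ∈ su n := by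
  refine ⟨?_, ?_⟩
  · simp [suZ, Matrix.conjTranspose_sub, Matrix.conjTranspose_single, ← Matrix.single_neg,
      div_eq_mul_inv]
    abel
  · simp [suZ, Matrix.trace_sub]

lemma stdNormSq_suX {i j : Fin n} (hij : i ≠ j) : stdNormSq (suX i j) = 1 / 2 := by
  simp [stdNormSq, suX, mul_add, add_mul, hij, hij.symm]
  norm_num

lemma stdNormSq_suY {i j : Fin n} (hij : i ≠ j) : stdNormSq (suY i j) = 1 / 2 := by
  simp [stdNormSq, suY, mul_sub, sub_mul, hij, hij.symm]
  norm_num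

lemma stdNormSq_suZ {i j : Fin n} (hij : i ≠ j) : stdNormSq (suZ i j) = 1 / 2 := by
  simp [stdNormSq, suZ, mul_sub, sub_mul, hij, hij.symm]
  norm_num

lemma exists_su_of_mem_generators {H : QOp n} (hH : H ∈ generators n) :
    ∃ h ∈ su n, oneBody h = H ∧ stdNormSq h = 1 / 2 := by
  obtain ⟨i, j, hij, rfl | rfl | rfl⟩ := hH
  · exact ⟨_, suX_mem i j hij, oneBody_suX hij, stdNormSq_suX hij⟩
  · exact ⟨_, suY_mem i j hij, oneBody_suY hij, stdNormSq_suY hij⟩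
  · exact ⟨_, suZ_mem i j, oneBody_suZ i j, stdNormSq_suZ hij⟩

end Generators

/-! ### The dynamical Lie algebra -/

section DLA

variable {n : ℕ}

/-- `su(n)` as a real subspace. -/
def suSubmodule (n : ℕ) : Submodule ℝ (Matrix (Fin n) (Fin n) ℂ) where
  carrier := su n
  add_mem' := by
    rintro a b ⟨ha, ha'⟩ ⟨hb, hb'⟩
    exact ⟨by rw [Matrix.conjTranspose_add, ha, hb, neg_add], by simp [ha', hb']⟩
  zero_mem' := by constructor <;> simp
  smul_mem' := by
    rintro c a ⟨ha, ha'⟩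
    exact ⟨by simp [Matrix.conjTranspose_smul, ha], by simp [ha']⟩

lemma lie_mem_su {a b : Matrix (Fin n) (Fin n) ℂ} (ha : a ∈ su n) (hb : b ∈ su n) :
    ⁅a, b⁆ ∈ su n := by
  refine ⟨?_, ?_⟩
  · rw [Ring.lie_def, Matrix.conjTranspose_sub, Matrix.conjTranspose_mul, Matrix.conjTranspose_mul,
      ha.1, hb.1]
    noncomm_ring
  · rw [Ring.lie_def, Matrix.trace_sub, Matrix.trace_mul_comm, sub_self]

/-- The image of `su(n)` under the differential of the compound representation. -/
noncomputable def suImage (n : ℕ) : LieSubalgebra ℝ (QOp n) where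
  toSubmodule := (suSubmodule n).map (oneBody.restrictScalars ℝ)
  lie_mem' := by
    rintro _ _ ⟨a, ha, rfl⟩ ⟨b, hb, rfl⟩
    exact ⟨⁅a, b⁆, lie_mem_su ha hb, (oneBody_lie a b).symm⟩

lemma mem_suImage {A : QOp n} : A ∈ suImage n ↔ ∃ a ∈ su n, oneBody a = A := Iff.rfl

/-- Because the preimages of the generators span su(n) linearly, no brackets are needed to fill the
DLA. -/
lemma suSubmodule_le_span (n : ℕ) : suSubmodule n ≤
    Submodule.span ℝ {a | ∃ i j : Fin n, i ≠ j ∧ (a = suX i j ∨ a = suY i j ∨ a = suZ i j)} := by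
  intro a ha
  set S := Submodule.span ℝ
    {a | ∃ i j : Fin n, i ≠ j ∧ (a = suX i j ∨ a = suY i j ∨ a = suZ i j)}
  have hX (i j : Fin n) (h : i ≠ j) : suX i j ∈ S := Submodule.subset_span ⟨i, j, h, .inl rfl⟩
  have hY (i j : Fin n) (h : i ≠ j) : suY i j ∈ S :=
    Submodule.subset_span ⟨i, j, h, .inr (.inl rfl)⟩
  have hZ (i j : Fin n) : suZ i j ∈ S := by
    rcases eq_or_ne i j with rfl | h
    · simp [suZ]
    · exact Submodule.subset_span ⟨i, j, h, .inr (.inr rfl)⟩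
  rcases Nat.eq_zero_or_pos n with rfl | hn
  · rw [Subsingleton.elim a 0]; exact S.zero_mem
  let o : Fin n := ⟨0, hn⟩
  have hstar (i j : Fin n) : (starRingEnd ℂ) (a i j) = -a j i := congrFun₂ ha.1 j i
  have hre (i : Fin n) : (a i i).re = 0 := by
    have := congrArg Complex.re (hstar i i)
    simp at this
    linarith
  have hij (i j : Fin n) : Matrix.single i j (a i j) + Matrix.single j i (a j i) =
      (2 * (a i j).re) • suY i j + (-2 * (a i j).im) • suX i j := by
    have h1 : a j i = -(starRingEnd ℂ) (a i j) := by rw [hstar, neg_neg]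
    rw [h1, suX, suY]
    simp only [smul_add, smul_sub, Matrix.smul_single, Complex.real_smul]
    rw [show Matrix.single i j (a i j) = Matrix.single i j (((2 * (a i j).re : ℝ) : ℂ) * (1 / 2)) +
        Matrix.single i j (((-2 * (a i j).im : ℝ) : ℂ) * -(Complex.I / 2)) by
      rw [← Matrix.single_add]; congr 1
      apply Complex.ext <;> simp <;> ring,
      show Matrix.single j i (-(starRingEnd ℂ) (a i j)) =
        -Matrix.single j i (((2 * (a i j).re : ℝ) : ℂ) * (1 / 2)) +
        Matrix.single j i (((-2 * (a i j).im : ℝ) : ℂ) * -(Complex.I / 2)) by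
      rw [Matrix.single_neg, ← Matrix.single_add]; congr 1
      apply Complex.ext <;> simp <;> ring]
    abel
  -- Each diagonal entry is moved to the reference site `o`; the amounts collected there sum to the
  -- trace, which is zero.
  have hii (i : Fin n) : Matrix.single i i (a i i) =
      (2 * (a i i).im) • suZ i o + Matrix.single o o (a i i) := by
    rw [suZ]
    simp only [smul_sub, Matrix.smul_single, Complex.real_smul]
    have : ((2 * (a i i).im : ℝ) : ℂ) * (Complex.I / 2) = a i i := by
      apply Complex.ext
      · simp [hre]
      · simp; ring
    rw [this]
    abel
  have hdiag : ∑ i, Matrix.single i i (a i i) ∈ S := by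
    have : ∑ i, Matrix.single i i (a i i) = ∑ i, (2 * (a i i).im) • suZ i o := by
      have h0 : ∑ i, Matrix.single o o (a i i) = 0 := by
        have := congrArg (Matrix.single o o) ha.2
        rw [Matrix.trace, Matrix.single_zero] at this
        rw [← this]
        exact (map_sum (Matrix.singleAddMonoidHom (α := ℂ) o o) _ _).symm
      rw [Finset.sum_congr rfl fun i _ => hii i, Finset.sum_add_distrib, h0, add_zero]
    rw [this]
    exact S.sum_mem fun i _ => S.smul_mem _ (hZ _ _)
  have hoff (i j : Fin n) (h : i ≠ j) :
      Matrix.single i j (a i j) + Matrix.single j i (a j i) ∈ S := by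
    rw [hij]
    exact S.add_mem (S.smul_mem _ (hY i j h)) (S.smul_mem _ (hX i j h))
  -- Adding `a` to itself with the summation indices swapped pairs entry (i, j) with (j, i), so no
  -- ordering of indices is needed.
  have h2 : (2 : ℝ) • a = (2 : ℝ) • ∑ i, Matrix.single i i (a i i) +
      ∑ i, ∑ j, if i = j then 0 else (Matrix.single i j (a i j) + Matrix.single j i (a j i)) := by
    have e1 : a = ∑ i, ∑ j, Matrix.single i j (a i j) := Matrix.matrix_eq_sum_single a
    have e2 : a = ∑ i, ∑ j, Matrix.single j i (a j i) := by rw [Finset.sum_comm]; exact e1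
    have e3 : ∑ i, Matrix.single i i (a i i) =
        ∑ i, ∑ j, if i = j then Matrix.single i j (a i j) else 0 := by simp
    rw [two_smul, two_smul]
    nth_rewrite 1 [e1]
    nth_rewrite 2 [e2]
    rw [e3]
    simp only [← Finset.sum_add_distrib]
    refine Finset.sum_congr rfl fun i _ => Finset.sum_congr rfl fun j _ => ?_
    split_ifs with h
    · subst h; simp
    · simp
  have h3 : (2 : ℝ) • a ∈ S := by
    rw [h2]
    refine S.add_mem (S.smul_mem _ hdiag) (S.sum_mem fun i _ => S.sum_mem fun j _ => ?_)
    split_ifs with h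
    · exact S.zero_mem
    · exact hoff i j h
  simpa [smul_smul] using S.smul_mem (1 / 2 : ℝ) h3

lemma dla_eq_suImage (n : ℕ) : dla n = suImage n := by
  apply le_antisymm
  · refine LieSubalgebra.lieSpan_le.mpr fun H hH => ?_
    obtain ⟨h, hh, rfl, -⟩ := exists_su_of_mem_generators hH
    exact mem_suImage.mpr ⟨h, hh, rfl⟩
  · rintro _ ⟨a, ha, rfl⟩
    have h := Submodule.mem_map_of_mem (f := oneBody.restrictScalars ℝ) (suSubmodule_le_span n ha)
    rw [Submodule.map_span] at h
    refine (Submodule.span_le (p := (dla n).toSubmodule)).mpr ?_ h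
    rintro _ ⟨a, ⟨i, j, hij, rfl | rfl | rfl⟩, rfl⟩
    · exact LieSubalgebra.subset_lieSpan ⟨i, j, hij, .inl (oneBody_suX hij)⟩
    · exact LieSubalgebra.subset_lieSpan ⟨i, j, hij, .inr (.inl (oneBody_suY hij))⟩
    · exact LieSubalgebra.subset_lieSpan ⟨i, j, hij, .inr (.inr (oneBody_suZ i j))⟩

/-- Multiplication by `i` identifies Hermitian and skew-Hermitian matrices. -/
noncomputable def selfAdjointEquivSkewAdjoint (n : ℕ) :
    selfAdjoint (Matrix (Fin n) (Fin n) ℂ) ≃ₗ[ℝ] skewAdjoint (Matrix (Fin n) (Fin n) ℂ) where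
  toFun a := ⟨Complex.I • (a : Matrix (Fin n) (Fin n) ℂ), by
    rw [skewAdjoint.mem_iff, star_smul, selfAdjoint.mem_iff.mp a.2]; simp⟩
  invFun a := ⟨(-Complex.I) • (a : Matrix (Fin n) (Fin n) ℂ), by
    rw [selfAdjoint.mem_iff, star_smul, skewAdjoint.mem_iff.mp a.2]; simp⟩
  map_add' a b := by ext1; simp
  map_smul' c a := Subtype.ext (smul_comm _ _ _)
  left_inv a := by ext1; simp [smul_smul]
  right_inv a := by ext1; simp [smul_smul]

/-- Hermitian and skew-Hermitian parts have equal dimension and together fill a real space of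
dimension 2n². -/
lemma finrank_skewAdjoint (n : ℕ) :
    Module.finrank ℝ (skewAdjoint (Matrix (Fin n) (Fin n) ℂ)) = n ^ 2 := by
  have h1 := (StarModule.decomposeProdAdjoint ℝ (Matrix (Fin n) (Fin n) ℂ)).finrank_eq
  have : Module.Finite ℝ (skewAdjoint (Matrix (Fin n) (Fin n) ℂ)) :=
    inferInstanceAs (Module.Finite ℝ (skewAdjoint.submodule ℝ (Matrix (Fin n) (Fin n) ℂ)))
  have : Module.Finite ℝ (selfAdjoint (Matrix (Fin n) (Fin n) ℂ)) :=
    inferInstanceAs (Module.Finite ℝ (selfAdjoint.submodule ℝ (Matrix (Fin n) (Fin n) ℂ)))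
  rw [Module.finrank_prod, (selfAdjointEquivSkewAdjoint n).finrank_eq, Module.finrank_matrix,
    Complex.finrank_real_complex] at h1
  simp only [Fintype.card_fin] at h1
  nlinarith

/-- Skew-Hermitian matrices have purely imaginary trace, so su(n) is the kernel of one nonzero real
functional, Im Tr. -/
lemma finrank_suSubmodule (hn : n ≠ 0) : Module.finrank ℝ (suSubmodule n) = n ^ 2 - 1 := by
  have : Module.Finite ℝ (skewAdjoint (Matrix (Fin n) (Fin n) ℂ)) :=
    inferInstanceAs (Module.Finite ℝ (skewAdjoint.submodule ℝ (Matrix (Fin n) (Fin n) ℂ)))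
  let τ : skewAdjoint.submodule ℝ (Matrix (Fin n) (Fin n) ℂ) →ₗ[ℝ] ℝ :=
    Complex.imLm ∘ₗ (Matrix.traceLinearMap (Fin n) ℝ ℂ) ∘ₗ
      (skewAdjoint.submodule ℝ (Matrix (Fin n) (Fin n) ℂ)).subtype
  have hker : (LinearMap.ker τ).map (skewAdjoint.submodule ℝ _).subtype = suSubmodule n := by
    ext a
    constructor
    · rintro ⟨⟨b, hb⟩, hb', rfl⟩
      have hs : bᴴ = -b := hb
      refine ⟨hs, ?_⟩
      have h1 : b.trace.im = 0 := hb'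
      have h2 := congrArg (fun m => (Matrix.trace m).re) hs
      simp [Matrix.trace_conjTranspose] at h2
      exact Complex.ext (by simp; linarith) h1
    · rintro ⟨ha, ha'⟩
      exact ⟨⟨a, ha⟩, by simp [τ, ha'], rfl⟩
  have hsurj : Function.Surjective τ := by
    intro r
    let o : Fin n := ⟨0, Nat.pos_of_ne_zero hn⟩
    refine ⟨⟨Matrix.single o o (r * Complex.I), ?_⟩, ?_⟩
    · change (Matrix.single o o (r * Complex.I))ᴴ = _
      simp [Matrix.conjTranspose_single, ← Matrix.single_neg]
    · simp [τ]
  have h := LinearMap.finrank_range_add_finrank_ker τ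
  rw [LinearMap.range_eq_top.mpr hsurj, finrank_top, Module.finrank_self,
    ← Submodule.finrank_map_subtype_eq, hker] at h
  have h2 : Module.finrank ℝ (skewAdjoint.submodule ℝ (Matrix (Fin n) (Fin n) ℂ)) = n ^ 2 :=
    finrank_skewAdjoint n
  omega

lemma finrank_dla (hn : n ≠ 0) : Module.finrank ℝ (dla n) = n ^ 2 - 1 := by
  rw [dla_eq_suImage, ← finrank_suSubmodule hn]
  exact (Submodule.equivMapOfInjective (oneBody.restrictScalars ℝ) oneBody_injective
    (suSubmodule n)).finrank_eq.symm

end DLA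

/-! ### Moments of the adjoint orbit under Haar measure -/

open MeasureTheory

section Haar

variable {n : ℕ}

instance instIsProbabilityMeasureHaarSU (n : ℕ) : IsProbabilityMeasure (haarSU n) :=
  ⟨Measure.haarMeasure_self (K₀ := ⊤)⟩

instance instIsMulLeftInvariantHaarSU (n : ℕ) : (haarSU n).IsMulLeftInvariant :=
  inferInstanceAs (Measure.haarMeasure (⊤ : TopologicalSpace.PositiveCompacts (SUn n))).IsMulLeftInvariant

/-- Makes the product σ-algebra on pairs of group elements Borel, so continuous functions of (g⁺,
g⁻) are measurable. -/
instance instSecondCountableSUn (n : ℕ) : SecondCountableTopology (SUn n) := by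
  have : SecondCountableTopology (Matrix (Fin n) (Fin n) ℂ) :=
    inferInstanceAs (SecondCountableTopology (Fin n → Fin n → ℂ))
  exact TopologicalSpace.Subtype.secondCountableTopology _

lemma SUn.conjTranspose_mul_self (g : SUn n) : (g : Matrix (Fin n) (Fin n) ℂ)ᴴ * g.1 = 1 :=
  Matrix.mem_unitaryGroup_iff'.mp (Matrix.mem_specialUnitaryGroup_iff.mp g.2).1

/-- Integration against the Haar measure, as a linear functional on continuous functions. -/
noncomputable def haarMean (n : ℕ) : C(SUn n, ℂ) →ₗ[ℂ] ℂ where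
  toFun f := ∫ g, f g ∂haarSU n
  map_add' f₁ f₂ := integral_add
    (f₁.continuous.integrable_of_hasCompactSupport (HasCompactSupport.of_compactSpace _))
    (f₂.continuous.integrable_of_hasCompactSupport (HasCompactSupport.of_compactSpace _))
  map_smul' c _ := integral_const_mul c _

lemma haarMean_apply (f : C(SUn n, ℂ)) : haarMean n f = ∫ g, f g ∂haarSU n := rfl

lemma haarMean_const (c : ℂ) : haarMean n (ContinuousMap.const _ c) = c := by
  simp [haarMean_apply]

/-- The orbit map `g ↦ g a g†`. -/
def orbit (a : Matrix (Fin n) (Fin n) ℂ) (g : SUn n) : Matrix (Fin n) (Fin n) ℂ :=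
  g.1 * a * g.1ᴴ

lemma continuous_orbit (a : Matrix (Fin n) (Fin n) ℂ) : Continuous (orbit a) := by
  unfold orbit
  fun_prop

/-- The matrix entries of `g a g†` as continuous functions of `g`. -/
def orbitEntry (a : Matrix (Fin n) (Fin n) ℂ) (i j : Fin n) : C(SUn n, ℂ) where
  toFun g := orbit a g i j
  continuous_toFun := (continuous_orbit a).matrix_elem i j

lemma orbitEntry_apply (a : Matrix (Fin n) (Fin n) ℂ) (i j : Fin n) (g : SUn n) :
    orbitEntry a i j g = orbit a g i j := rfl

/-- Every unitary matrix is a phase times a special unitary matrix. -/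
lemma exists_smul_specialUnitary {u : Matrix (Fin n) (Fin n) ℂ} (hn : n ≠ 0) (hu : uᴴ * u = 1) :
    ∃ (z : ℂ) (s : SUn n), z * star z = 1 ∧ u = z • s.1 := by
  obtain ⟨z, hz⟩ := IsAlgClosed.exists_pow_nat_eq u.det (Nat.pos_of_ne_zero hn)
  have hdet : ‖u.det‖ = 1 := by
    have h := congrArg Matrix.det hu
    rw [Matrix.det_mul, Matrix.det_conjTranspose, Matrix.det_one] at h
    have h2 : ‖u.det‖ ^ 2 = 1 := by
      have := congrArg norm h
      simpa [sq] using this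
    exact (pow_eq_one_iff_of_nonneg (norm_nonneg _) two_ne_zero).mp h2
  have hz1 : ‖z‖ = 1 := by
    rw [← hz, norm_pow] at hdet
    exact (pow_eq_one_iff_of_nonneg (norm_nonneg _) hn).mp hdet
  have hzz : z * star z = 1 := by
    rw [Complex.star_def, Complex.mul_conj, Complex.normSq_eq_norm_sq, hz1]; simp
  have hz0 : z ≠ 0 := by rintro rfl; simp at hz1
  refine ⟨z, ⟨star z • u, ?_⟩, hzz, by rw [smul_smul, hzz, one_smul]⟩
  rw [Matrix.mem_specialUnitaryGroup_iff, Matrix.mem_unitaryGroup_iff', Matrix.star_eq_conjTranspose]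
  refine ⟨?_, ?_⟩
  · rw [Matrix.conjTranspose_smul, smul_mul_smul_comm, hu, star_star, hzz, one_smul]
  · rw [Matrix.det_smul, Fintype.card_fin, ← hz, ← mul_pow, mul_comm, hzz, one_pow]

/-- Phases cancel under conjugation, so the orbit average is invariant under all of U(n). Test
unitaries of any determinant are thereby allowed. -/
lemma integral_orbit_conj {u : Matrix (Fin n) (Fin n) ℂ} (hn : n ≠ 0) (hu : uᴴ * u = 1)
    (a : Matrix (Fin n) (Fin n) ℂ) (F : Matrix (Fin n) (Fin n) ℂ → ℂ) :
    ∫ g, F (u * orbit a g * uᴴ) ∂haarSU n = ∫ g, F (orbit a g) ∂haarSU n := by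
  obtain ⟨z, s, hz, rfl⟩ := exists_smul_specialUnitary hn hu
  refine Eq.trans ?_ (integral_mul_left_eq_self (fun g => F (orbit a g)) s)
  congr 1
  funext g
  congr 1
  rw [Matrix.conjTranspose_smul, smul_mul_assoc, smul_mul_assoc, mul_smul_comm, smul_smul, hz,
    one_smul]
  simp only [orbit, Submonoid.coe_mul, Matrix.conjTranspose_mul, mul_assoc]

/-- Second moments of the entries of `g a g†`. -/
noncomputable def moment (a : Matrix (Fin n) (Fin n) ℂ) (i j k l : Fin n) : ℂ :=
  haarMean n (orbitEntry a i j * orbitEntry a k l)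

lemma moment_eq (a : Matrix (Fin n) (Fin n) ℂ) (i j k l : Fin n) :
    moment a i j k l = ∫ g, orbit a g i j * orbit a g k l ∂haarSU n := rfl

/-- The diagonal unitary with entry `i` at position `p`. -/
noncomputable def phaseAt (p : Fin n) : Fin n → ℂ := fun k => if k = p then Complex.I else 1

lemma phaseAt_unitary (p : Fin n) :
    (Matrix.diagonal (phaseAt p))ᴴ * Matrix.diagonal (phaseAt p) = 1 := by
  rw [Matrix.diagonal_conjTranspose, Matrix.diagonal_mul_diagonal, ← Matrix.diagonal_one]
  congr 1
  funext k
  by_cases h : k = p <;> simp [phaseAt, h]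

lemma diagonal_conj_apply (d : Fin n → ℂ) (x : Matrix (Fin n) (Fin n) ℂ) (i j : Fin n) :
    (Matrix.diagonal d * x * (Matrix.diagonal d)ᴴ) i j = d i * x i j * star (d j) := by
  rw [Matrix.diagonal_conjTranspose, Matrix.mul_diagonal, Matrix.diagonal_mul]
  rfl

lemma moment_phase (hn : n ≠ 0) (a : Matrix (Fin n) (Fin n) ℂ) (i j k l p : Fin n) :
    (phaseAt p i * star (phaseAt p j) * (phaseAt p k * star (phaseAt p l))) * moment a i j k l =
      moment a i j k l := by
  have h := integral_orbit_conj hn (phaseAt_unitary p) a fun x => x i j * x k l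
  simp only [diagonal_conj_apply] at h
  rw [moment_eq, ← integral_const_mul]
  refine Eq.trans ?_ h
  congr 1
  funext g
  ring

lemma mean_phase (hn : n ≠ 0) (a : Matrix (Fin n) (Fin n) ℂ) (i j p : Fin n) :
    (phaseAt p i * star (phaseAt p j)) * haarMean n (orbitEntry a i j) =
      haarMean n (orbitEntry a i j) := by
  have h := integral_orbit_conj hn (phaseAt_unitary p) a fun x => x i j
  simp only [diagonal_conj_apply] at h
  rw [haarMean_apply, ← integral_const_mul]
  refine Eq.trans ?_ h
  congr 1
  funext g
  rw [orbitEntry_apply]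
  ring

lemma mean_eq_zero_of_ne (hn : n ≠ 0) (a : Matrix (Fin n) (Fin n) ℂ) {i j : Fin n} (hij : i ≠ j) :
    haarMean n (orbitEntry a i j) = 0 := by
  have h := mean_phase hn a i j i
  simp only [phaseAt, if_true, hij.symm, if_false, star_one, mul_one] at h
  by_contra h0
  have := congrArg Complex.im (mul_right_cancel₀ h0 (h.trans (one_mul _).symm))
  simp at this

/-- A phase at `p` multiplies the moment by a power of i: occurrences of `p` among row indices minus
those among column indices. A nonzero moment needs equal row and column multisets. The phase i,
unlike −1, also detects an excess of two. -/
lemma moment_eq_zero (hn : n ≠ 0) (a : Matrix (Fin n) (Fin n) ℂ) {i j k l : Fin n}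
    (h1 : ¬(i = j ∧ k = l)) (h2 : ¬(i = l ∧ k = j)) : moment a i j k l = 0 := by
  by_contra h0
  have h (p : Fin n) := mul_right_cancel₀ h0 ((moment_phase hn a i j k l p).trans (one_mul _).symm)
  have key : i = j ∨ i = l := by
    by_contra! hc
    have := h i
    by_cases hk : k = i
    · have := congrArg Complex.re this
      simp [phaseAt, hc.1.symm, hc.2.symm, hk] at this
      norm_num at this
    · have := congrArg Complex.im this
      simp [phaseAt, hc.1.symm, hc.2.symm, hk] at this
  rcases key with rfl | rfl
  · have hkl : k ≠ l := fun e => h1 ⟨rfl, e⟩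
    have hu (d : ℂ) (hd : d = 1 ∨ d = Complex.I) : d * star d = 1 := by
      rcases hd with rfl | rfl <;> simp
    have := h k
    rw [hu _ (by unfold phaseAt; split_ifs <;> simp)] at this
    have := congrArg Complex.im this
    simp [phaseAt, hkl.symm] at this
  · have hkl : k ≠ j := fun e => h2 ⟨rfl, e⟩
    have hu (d : ℂ) (hd : d = 1 ∨ d = Complex.I) : d * star d = 1 := by
      rcases hd with rfl | rfl <;> simp
    have := h k
    rw [show ∀ x y z w : ℂ, x * y * (z * w) = (x * w) * (z * y) by intros; ring,
      hu _ (by unfold phaseAt; split_ifs <;> simp)] at this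
    have := congrArg Complex.im this
    simp [phaseAt, hkl.symm] at this

lemma permMatrix_unitary (σ : Equiv.Perm (Fin n)) :
    ((1 : Matrix (Fin n) (Fin n) ℂ).submatrix σ id)ᴴ *
      (1 : Matrix (Fin n) (Fin n) ℂ).submatrix σ id = 1 := by
  rw [Matrix.conjTranspose_submatrix, Matrix.conjTranspose_one, Matrix.submatrix_mul_equiv]
  simp

lemma permMatrix_conj (σ : Equiv.Perm (Fin n)) (x : Matrix (Fin n) (Fin n) ℂ) :
    (1 : Matrix (Fin n) (Fin n) ℂ).submatrix σ id * x *
      ((1 : Matrix (Fin n) (Fin n) ℂ).submatrix σ id)ᴴ = x.submatrix σ σ := by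
  ext i j
  simp [Matrix.mul_apply, Matrix.one_apply]

lemma moment_perm (hn : n ≠ 0) (a : Matrix (Fin n) (Fin n) ℂ) (σ : Equiv.Perm (Fin n))
    (i j k l : Fin n) : moment a (σ i) (σ j) (σ k) (σ l) = moment a i j k l := by
  have h := integral_orbit_conj hn (permMatrix_unitary σ) a fun x => x i j * x k l
  simp only [permMatrix_conj, Matrix.submatrix_apply] at h
  exact h

lemma mean_perm (hn : n ≠ 0) (a : Matrix (Fin n) (Fin n) ℂ) (σ : Equiv.Perm (Fin n))
    (i j : Fin n) : haarMean n (orbitEntry a (σ i) (σ j)) = haarMean n (orbitEntry a i j) := by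
  have h := integral_orbit_conj hn (permMatrix_unitary σ) a fun x => x i j
  simp only [permMatrix_conj, Matrix.submatrix_apply] at h
  exact h

lemma exists_perm_pair {i k i' k' : Fin n} (h : i ≠ k) (h' : i' ≠ k') :
    ∃ σ : Equiv.Perm (Fin n), σ i = i' ∧ σ k = k' := by
  have hk : Equiv.swap i i' k ≠ i' := fun e =>
    h ((Equiv.swap i i').injective (e.trans (Equiv.swap_apply_left i i').symm)).symm
  refine ⟨Equiv.swap (Equiv.swap i i' k) k' * Equiv.swap i i', ?_, ?_⟩
  · rw [Equiv.Perm.mul_apply, Equiv.swap_apply_left, Equiv.swap_apply_of_ne_of_ne hk.symm h']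
  · rw [Equiv.Perm.mul_apply, Equiv.swap_apply_left]

lemma orbit_trace (a : Matrix (Fin n) (Fin n) ℂ) (g : SUn n) : (orbit a g).trace = a.trace := by
  rw [orbit, Matrix.trace_mul_comm, ← mul_assoc, g.conjTranspose_mul_self, one_mul]

lemma orbit_mul_orbit (a b : Matrix (Fin n) (Fin n) ℂ) (g : SUn n) :
    orbit a g * orbit b g = orbit (a * b) g := by
  simp only [orbit, mul_assoc]
  rw [← mul_assoc g.1ᴴ g.1, g.conjTranspose_mul_self, one_mul]

/-- A reflection mixing the coordinates `i` and `j`. -/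
noncomputable def mixing (i j : Fin n) : Matrix (Fin n) (Fin n) ℂ :=
  1 - (2 / 5 : ℂ) • Matrix.vecMulVec (Pi.single i 1 + Pi.single j 2) (Pi.single i 1 + Pi.single j 2)

lemma mixing_conjTranspose (i j : Fin n) : (mixing i j)ᴴ = mixing i j := by
  have h : star (Pi.single i 1 + Pi.single j 2 : Fin n → ℂ) = Pi.single i 1 + Pi.single j 2 := by
    ext k
    simp only [Pi.star_apply, Pi.add_apply, Pi.single_apply]
    split_ifs <;> simp
  rw [mixing, Matrix.conjTranspose_sub, Matrix.conjTranspose_smul, Matrix.conjTranspose_vecMulVec,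
    Matrix.conjTranspose_one, h]
  simp

lemma mixing_unitary {i j : Fin n} (hij : i ≠ j) : (mixing i j)ᴴ * mixing i j = 1 := by
  rw [mixing_conjTranspose, mixing]
  have : Matrix.vecMulVec (Pi.single i 1 + Pi.single j 2 : Fin n → ℂ)
      (Pi.single i 1 + Pi.single j 2) * Matrix.vecMulVec (Pi.single i 1 + Pi.single j 2)
      (Pi.single i 1 + Pi.single j 2) = (5 : ℂ) • Matrix.vecMulVec (Pi.single i 1 + Pi.single j 2)
      (Pi.single i 1 + Pi.single j 2) := by
    have hd : (Pi.single i 1 + Pi.single j 2 : Fin n → ℂ) ⬝ᵥ (Pi.single i 1 + Pi.single j 2) = 5 := by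
      simp [hij, hij.symm]
      norm_num
    rw [Matrix.vecMulVec_mul_vecMulVec, hd, Matrix.vecMulVec_smul]
  rw [sub_mul, mul_sub, mul_sub, smul_mul_smul_comm, this]
  simp only [one_mul, mul_one]
  module

lemma mixing_conj_apply {i j : Fin n} (hij : i ≠ j) (x : Matrix (Fin n) (Fin n) ℂ) :
    (mixing i j * x * (mixing i j)ᴴ) i i =
      9 / 25 * x i i - 12 / 25 * x i j - 12 / 25 * x j i + 16 / 25 * x j j := by
  have hrow (v : Fin n → ℂ) : ∑ p, mixing i j i p * v p = 3 / 5 * v i - 4 / 5 * v j := by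
    simp [mixing, Matrix.vecMulVec_apply, Matrix.one_apply, Pi.single_apply, hij, sub_mul, mul_add,
      add_mul, Finset.sum_add_distrib]
    ring
  have hsymm (p : Fin n) : (mixing i j)ᴴ p i = mixing i j i p := by
    rw [mixing_conjTranspose]
    rcases eq_or_ne p i with rfl | h
    · rfl
    · simp [mixing, Matrix.vecMulVec_apply, h, h.symm, mul_comm]
  simp only [Matrix.mul_apply, hsymm, hrow]
  simp only [mul_comm _ (mixing i j i _), hrow]
  ring

/-- Supplies the relation that phases and permutations cannot see. The reflection along e_i + 2e_j
has the rational row (3/5, −4/5), and the cross coefficient is 2 · (12/25)² = 288/625. -/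
lemma moment_mixing (hn : n ≠ 0) (a : Matrix (Fin n) (Fin n) ℂ) {i j : Fin n} (hij : i ≠ j) :
    moment a i i i i = (81 / 625) * moment a i i i i + (256 / 625) * moment a j j j j +
      (288 / 625) * (moment a i i j j + moment a i j j i) := by
  have h := integral_orbit_conj hn (mixing_unitary hij) a fun x => x i i * x i i
  simp only [mixing_conj_apply hij] at h
  set X := orbitEntry a
  set Y : C(SUn n, ℂ) := (9 / 25 : ℂ) • X i i - (12 / 25 : ℂ) • X i j - (12 / 25 : ℂ) • X j i +
    (16 / 25 : ℂ) • X j j with hY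
  have h' : haarMean n (Y * Y) = moment a i i i i := h
  have hYY : Y * Y = (81 / 625 : ℂ) • (X i i * X i i) + (256 / 625 : ℂ) • (X j j * X j j) +
      (288 / 625 : ℂ) • (X i i * X j j + X i j * X j i) +
      (144 / 625 : ℂ) • (X i j * X i j + X j i * X j i) -
      (216 / 625 : ℂ) • (X i i * X i j + X i i * X j i) -
      (384 / 625 : ℂ) • (X j j * X i j + X j j * X j i) := by
    ext g
    simp [hY]
    ring
  refine h'.symm.trans ?_
  rw [hYY]
  simp only [map_add, map_sub, map_smul, smul_eq_mul]
  change _ + _ + _ * (_ + _) + _ * (moment a i j i j + moment a j i j i) -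
    _ * (moment a i i i j + moment a i i j i) - _ * (moment a j j i j + moment a j j j i) = _
  rw [moment_eq_zero hn a (i := i) (j := j) (k := i) (l := j),
    moment_eq_zero hn a (i := j) (j := i) (k := j) (l := i),
    moment_eq_zero hn a (i := i) (j := i) (k := i) (l := j),
    moment_eq_zero hn a (i := i) (j := i) (k := j) (l := i),
    moment_eq_zero hn a (i := j) (j := j) (k := i) (l := j),
    moment_eq_zero hn a (i := j) (j := j) (k := j) (l := i)]
  · simp only [mul_zero, add_zero, sub_zero]
    rfl
  all_goals simp [hij, hij.symm]

/-- Phases kill the off-diagonal means; permutations equate the diagonal ones, whose sum is the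
trace. -/
lemma mean_orbitEntry (hn : n ≠ 0) {a : Matrix (Fin n) (Fin n) ℂ} (ha : a.trace = 0) (i j : Fin n) :
    haarMean n (orbitEntry a i j) = 0 := by
  by_cases hij : i = j
  · subst hij
    have h1 : ∑ k, haarMean n (orbitEntry a k k) = 0 := by
      rw [← map_sum]
      have : ∑ k, orbitEntry a k k = 0 := by
        ext g
        rw [ContinuousMap.sum_apply]
        exact (orbit_trace a g).trans ha
      rw [this, map_zero]
    have h2 (k : Fin n) : haarMean n (orbitEntry a k k) = haarMean n (orbitEntry a i i) := by
      have := mean_perm hn a (Equiv.swap i k) i i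
      rwa [Equiv.swap_apply_left] at this
    simp only [h2, Finset.sum_const, Finset.card_univ, Fintype.card_fin, nsmul_eq_mul] at h1
    exact (mul_eq_zero.mp h1).resolve_left (Nat.cast_ne_zero.mpr hn)
  · exact mean_eq_zero_of_ne hn a hij

/-- The second moments of the adjoint orbit of a traceless matrix. -/
lemma moment_formula (hn : 2 ≤ n) {a : Matrix (Fin n) (Fin n) ℂ} (ha : a.trace = 0)
    (i j k l : Fin n) :
    moment a i j k l = (a * a).trace / ((n : ℂ) ^ 2 - 1) *
      ((if i = l ∧ k = j then 1 else 0) - (if i = j ∧ k = l then 1 else 0) / n) := by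
  have hn0 : n ≠ 0 := by omega
  let i₀ : Fin n := ⟨0, by omega⟩
  let k₀ : Fin n := ⟨1, by omega⟩
  have h₀ : i₀ ≠ k₀ := by simp [i₀, k₀]
  -- Permutation symmetry leaves three unknowns. They are fixed by the reflection (`e1`), by Tr x =
  -- 0 (`e2`) and by the constancy of Tr x² on the orbit (`e3`).
  obtain ⟨p, hp⟩ : ∃ p, p = moment a i₀ i₀ k₀ k₀ := ⟨_, rfl⟩
  obtain ⟨q, hq⟩ : ∃ q, q = moment a i₀ k₀ k₀ i₀ := ⟨_, rfl⟩
  obtain ⟨r, hr⟩ : ∃ r, r = moment a i₀ i₀ i₀ i₀ := ⟨_, rfl⟩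
  have hP (i k : Fin n) (h : i ≠ k) : moment a i i k k = p := by
    obtain ⟨σ, rfl, rfl⟩ := exists_perm_pair h₀ h
    rw [moment_perm hn0, hp]
  have hQ (i k : Fin n) (h : i ≠ k) : moment a i k k i = q := by
    obtain ⟨σ, rfl, rfl⟩ := exists_perm_pair h₀ h
    rw [moment_perm hn0, hq]
  have hR (i : Fin n) : moment a i i i i = r := by
    have := moment_perm hn0 a (Equiv.swap i₀ i) i₀ i₀ i₀ i₀
    rwa [Equiv.swap_apply_left, ← hr] at this
  have e1 : r = p + q := by
    have := moment_mixing hn0 a h₀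
    rw [hR, hR, hP _ _ h₀, hQ _ _ h₀] at this
    linear_combination (625 / 288) * this
  have hsum (f : Fin n → ℂ) (i : Fin n) (c d : ℂ) (h1 : f i = c) (h2 : ∀ k, i ≠ k → f k = d) :
      ∑ k, f k = c + (n - 1) * d := by
    rw [← Finset.add_sum_erase _ _ (Finset.mem_univ i), h1,
      Finset.sum_congr rfl fun k hk => h2 k (Finset.ne_of_mem_erase hk).symm]
    rw [Finset.sum_const, Finset.card_erase_of_mem (Finset.mem_univ i), Finset.card_univ,
      Fintype.card_fin, nsmul_eq_mul, Nat.cast_sub (by omega)]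
    simp
  have e2 : r + (n - 1) * p = 0 := by
    rw [← hsum (fun k => moment a i₀ i₀ k k) i₀ r p (hR i₀) (fun k hk => hP _ _ hk)]
    simp only [moment, ← map_sum, ← Finset.mul_sum]
    have : ∑ k, orbitEntry a k k = 0 := by
      ext g
      rw [ContinuousMap.sum_apply]
      exact (orbit_trace a g).trans ha
    rw [this, mul_zero, map_zero]
  have e3 : n * (r + (n - 1) * q) = (a * a).trace := by
    have h1 : ∑ i, ∑ k, moment a i k k i = n * (r + (n - 1) * q) := by
      rw [Finset.sum_congr rfl fun i _ => hsum (fun k => moment a i k k i) i r q (hR i)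
        (fun k hk => hQ _ _ hk)]
      rw [Finset.sum_const, Finset.card_univ, Fintype.card_fin, nsmul_eq_mul]
    rw [← h1]
    simp only [moment, ← map_sum]
    rw [← haarMean_const (n := n) (a * a).trace]
    congr 1
    ext g
    simp only [ContinuousMap.sum_apply, ContinuousMap.mul_apply, orbitEntry_apply,
      ContinuousMap.const_apply]
    rw [← orbit_trace _ g, ← orbit_mul_orbit]
    simp [Matrix.trace, Matrix.mul_apply]
  have hnC : (n : ℂ) ≠ 0 := Nat.cast_ne_zero.mpr hn0
  have hd : (n : ℂ) ^ 2 - 1 ≠ 0 := by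
    have : ((n ^ 2 : ℕ) : ℂ) ≠ (1 : ℕ) := by
      rw [Ne, Nat.cast_inj]
      nlinarith
    push_cast at this
    exact sub_ne_zero.mpr this
  have eq1 : q = (a * a).trace / ((n : ℂ) ^ 2 - 1) := by
    rw [eq_div_iff hd]
    linear_combination e3 - (n : ℂ) * e1 - e2 + e1
  have ep1 : p = -((a * a).trace / ((n : ℂ) ^ 2 - 1)) / n := by
    rw [← eq1, eq_div_iff hnC]
    linear_combination e2 - e1
  rw [← eq1] at ep1 ⊢
  by_cases h1 : i = j ∧ k = l
  · obtain ⟨rfl, rfl⟩ := h1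
    by_cases h2 : i = k
    · subst h2
      rw [hR, e1, ep1]; simp; ring
    · rw [hP _ _ h2, ep1]; simp [h2]; ring
  · by_cases h2 : i = l ∧ k = j
    · obtain ⟨rfl, rfl⟩ := h2
      rw [hQ _ _ (fun e => h1 ⟨e, e.symm⟩)]
      simp only [h1, if_false]
      simp
    · rw [moment_eq_zero hn0 a h1 h2]
      simp [h1, h2]

end Haar

/-! ### Overlaps with the uniform superposition -/

section PlusState

variable {n : ℕ}

lemma plusState_apply (x y : Bits n) : plusState n x y = ∏ _k : Fin n, (1 / 2 : ℂ) := by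
  have h : ((1 / √2 : ℝ) : ℂ) * ((1 / √2 : ℝ) : ℂ) = 1 / 2 := by
    rw [← Complex.ofReal_mul, div_mul_div_comm, Real.mul_self_sqrt zero_le_two]
    simp
  rw [plusState, Matrix.vecMulVec_apply, Pi.star_apply, plusVec, plusVec, star_prod,
    ← Finset.prod_mul_distrib]
  simp only [Complex.star_def, Complex.conj_ofReal, h]

/-- All entries of the plus state equal 2⁻ⁿ, so the trace sums all entries of the operator and
factors over sites. -/
lemma trace_plusState_mul_tensorOp (P : Fin n → Matrix (Fin 2) (Fin 2) ℂ) :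
    (plusState n * tensorOp P).trace = ∏ k, (1 / 2 * ∑ a, ∑ b, P k a b) := by
  rw [Finset.prod_mul_distrib, Finset.prod_univ_sum, Finset.mul_sum, Matrix.trace]
  simp only [Matrix.diag_apply, Matrix.mul_apply, plusState_apply, Fintype.piFinset_univ,
    Finset.prod_univ_sum, Finset.mul_sum, tensorOp_apply]
  exact Finset.sum_comm

/-- The one-body reduced density matrix of the uniform superposition. -/
noncomputable def plusMat (n : ℕ) : Matrix (Fin n) (Fin n) ℂ :=
  Matrix.of fun i j => if i = j then 1 / 2 else
    if (i : ℕ) + 1 = j ∨ (j : ℕ) + 1 = i then 1 / 4 else 0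

lemma plusMat_comm (i j : Fin n) : plusMat n i j = plusMat n j i := by
  simp only [plusMat, Matrix.of_apply, eq_comm (a := i), or_comm]

/-- Raising, lowering and |1⟩⟨1| each have expectation 1/2 in |+⟩, while `σz` has expectation 0; one
site strictly between `i` and `j` therefore kills the overlap. -/
lemma trace_plusState_mul_cr_mul_an (i j : Fin n) :
    (plusState n * (cr i * an j)).trace = plusMat n i j := by
  rcases eq_or_ne i j with rfl | hij
  · rw [cr, an, jordanWigner, jordanWigner, tensorOp_mul, trace_plusState_mul_tensorOp,
      Finset.prod_eq_single i]
    · simp [plusMat, raiseMat, lowerMat]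
    · intro k _ hk
      rcases lt_or_gt_of_ne hk with h | h
      · simp [h, σz_mul_σz, Matrix.one_apply]
      · simp [h.not_gt, hk, Matrix.one_apply]
    · simp
  · rw [cr_mul_an hij, pauliString, trace_plusState_mul_tensorOp]
    simp only [plusMat, Matrix.of_apply, hij, if_false]
    split_ifs with hadj
    · have h (k : Fin n) : (1 / 2 * ∑ a, ∑ b, (if k = i then raiseMat else if k = j then lowerMat
          else if min i j < k ∧ k < max i j then σz else 1) a b : ℂ) =
          (if k = i then 1 / 2 else 1) * (if k = j then 1 / 2 else 1) := by
        have hk : ¬(min i j < k ∧ k < max i j) := by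
          rintro ⟨h1, h2⟩
          rw [min_lt_iff, Fin.lt_def, Fin.lt_def] at h1
          rw [lt_max_iff, Fin.lt_def, Fin.lt_def] at h2
          omega
        rw [if_neg hk]
        by_cases hi : k = i
        · subst hi; simp [hij, raiseMat]
        · by_cases hj : k = j
          · subst hj; simp [hi, lowerMat]
          · simp [hi, hj, Matrix.one_apply]
      rw [Finset.prod_congr rfl fun k _ => h k, Finset.prod_mul_distrib]
      simp
      norm_num
    · push Not at hadj
      obtain ⟨k, h1, h2⟩ : ∃ k : Fin n, min i j < k ∧ k < max i j := by
        have hij' : (i : ℕ) ≠ j := fun e => hij (Fin.ext e)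
        rcases lt_or_gt_of_ne hij' with h | h
        · refine ⟨⟨i + 1, by omega⟩, min_lt_iff.mpr (.inl ?_), lt_max_iff.mpr (.inr ?_)⟩
          · exact Nat.lt_succ_self i
          · exact Fin.lt_def.mpr (lt_of_le_of_ne (Nat.succ_le_of_lt h) hadj.1)
        · refine ⟨⟨j + 1, by omega⟩, min_lt_iff.mpr (.inr ?_), lt_max_iff.mpr (.inl ?_)⟩
          · exact Nat.lt_succ_self j
          · exact Fin.lt_def.mpr (lt_of_le_of_ne (Nat.succ_le_of_lt h) hadj.2)
      refine Finset.prod_eq_zero (Finset.mem_univ k) ?_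
      have hki : k ≠ i := by rintro rfl; rcases lt_or_gt_of_ne hij with h | h <;> simp_all [le_of_lt]
      have hkj : k ≠ j := by rintro rfl; rcases lt_or_gt_of_ne hij with h | h <;> simp_all [le_of_lt]
      simp only [hki, hkj, h1, h2, and_self, if_true, if_false]
      simp [σz]

lemma trace_plusState_mul_oneBody (a : Matrix (Fin n) (Fin n) ℂ) :
    (plusState n * oneBody a).trace = (plusMat n * a).trace := by
  rw [oneBody_eq_sum]
  simp only [Finset.mul_sum, mul_smul_comm, Matrix.trace_sum, Matrix.trace_smul,
    trace_plusState_mul_cr_mul_an, smul_eq_mul]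
  rw [Finset.sum_comm]
  simp only [Matrix.trace, Matrix.diag_apply, Matrix.mul_apply]
  exact Finset.sum_congr rfl fun i _ => Finset.sum_congr rfl fun j _ => by
    rw [plusMat_comm, mul_comm]

lemma plusMat_conjTranspose (n : ℕ) : (plusMat n)ᴴ = plusMat n := by
  ext i j
  rw [Matrix.conjTranspose_apply, plusMat_comm]
  simp only [plusMat, Matrix.of_apply]
  split_ifs <;> simp

lemma trace_plusMat (n : ℕ) : (plusMat n).trace = n / 2 := by
  simp [Matrix.trace, plusMat, div_eq_mul_inv]

lemma sum_succ_eq (hn : n ≠ 0) :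
    ∑ i : Fin n, ∑ j : Fin n, (if (i : ℕ) + 1 = j then (1 : ℂ) else 0) = n - 1 := by
  obtain ⟨m, rfl⟩ := Nat.exists_eq_succ_of_ne_zero hn
  have h (i : Fin (m + 1)) : ∑ j : Fin (m + 1), (if (i : ℕ) + 1 = j then (1 : ℂ) else 0) =
      if (i : ℕ) < m then 1 else 0 := by
    split_ifs with hi
    · rw [Finset.sum_eq_single ⟨i + 1, by omega⟩]
      · simp
      · intro b _ hb
        rw [if_neg fun e => hb (Fin.ext e.symm)]
      · simp
    · refine Finset.sum_eq_zero fun j _ => if_neg ?_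
      omega
  rw [Finset.sum_congr rfl fun i _ => h i, Fin.sum_univ_castSucc]
  simp

lemma trace_plusMat_mul_self (hn : n ≠ 0) :
    (plusMat n * plusMat n).trace = n / 4 + (n - 1) / 8 := by
  have h (i j : Fin n) : plusMat n i j * plusMat n j i = (if i = j then 1 / 4 else 0) +
      1 / 16 * (if (i : ℕ) + 1 = j then 1 else 0) + 1 / 16 * (if (j : ℕ) + 1 = i then 1 else 0) := by
    rw [plusMat_comm j i]
    simp only [plusMat, Matrix.of_apply]
    by_cases h1 : i = j
    · subst h1; simp; norm_num
    · by_cases h2 : (i : ℕ) + 1 = j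
      · have h3 : ¬((j : ℕ) + 1 = i) := by omega
        simp [h1, h2, h3]; norm_num
      · by_cases h3 : (j : ℕ) + 1 = i
        · simp [h1, h2, h3]; norm_num
        · simp [h1, h2, h3]
  simp only [Matrix.trace, Matrix.diag_apply, Matrix.mul_apply, h, Finset.sum_add_distrib,
    ← Finset.mul_sum, sum_succ_eq hn]
  rw [Finset.sum_comm (f := fun i j : Fin n => if (j : ℕ) + 1 = i then (1 : ℂ) else 0),
    sum_succ_eq hn]
  simp
  ring

end PlusState

/-! ### The gradient variance -/

section Variance

variable {n : ℕ}

/-- The Haar average of a quadratic form on the adjoint orbit of a traceless matrix. -/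
lemma integral_quadratic_orbit (hn : 2 ≤ n) {a : Matrix (Fin n) (Fin n) ℂ} (ha : a.trace = 0)
    (c : Fin n → Fin n → Fin n → Fin n → ℂ) :
    ∫ g, ∑ i, ∑ j, ∑ k, ∑ l, c i j k l * (orbit a g i j * orbit a g k l) ∂haarSU n =
      (a * a).trace / ((n : ℂ) ^ 2 - 1) *
        (∑ i, ∑ j, c i j j i - (∑ i, ∑ k, c i i k k) / n) := by
  have h : ∫ g, ∑ i, ∑ j, ∑ k, ∑ l, c i j k l * (orbit a g i j * orbit a g k l) ∂haarSU n =
      haarMean n (∑ i, ∑ j, ∑ k, ∑ l, c i j k l • (orbitEntry a i j * orbitEntry a k l)) := by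
    rw [haarMean_apply]
    simp only [ContinuousMap.sum_apply, ContinuousMap.smul_apply, ContinuousMap.mul_apply,
      orbitEntry_apply, smul_eq_mul]
  have h2 (i j k l : Fin n) : c i j k l * moment a i j k l = (a * a).trace / ((n : ℂ) ^ 2 - 1) *
      ((if k = j then if i = l then c i j k l else 0 else 0) -
        (if i = j then if k = l then c i j k l else 0 else 0) / n) := by
    -- The indicators are nested so that the sums over Kronecker deltas collapse one index at a
    -- time.
    have key (p q r s : Prop) [Decidable p] [Decidable q] [Decidable r] [Decidable s] (x t : ℂ) :
        x * (t * ((if p ∧ q then 1 else 0) - (if r ∧ s then 1 else 0) / n)) =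
        t * ((if q then if p then x else 0 else 0) - (if r then if s then x else 0 else 0) / n) := by
      by_cases h1 : p <;> by_cases h2 : q <;> by_cases h3 : r <;> by_cases h4 : s <;>
        simp only [h1, h2, h3, h4, and_self, and_true, and_false, if_true, if_false] <;> ring
    rw [moment_formula hn ha, key]
  rw [h]
  simp only [map_sum, map_smul, smul_eq_mul]
  change ∑ i, ∑ j, ∑ k, ∑ l, c i j k l * moment a i j k l = _
  simp only [h2, ← Finset.mul_sum, Finset.sum_sub_distrib, ← Finset.sum_div]
  congr 2
  · simp
  · congr 1
    simp

lemma integral_trace_mul_orbit_sq (hn : 2 ≤ n) {a : Matrix (Fin n) (Fin n) ℂ} (ha : a.trace = 0)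
    (P : Matrix (Fin n) (Fin n) ℂ) :
    ∫ g, (P * orbit a g).trace ^ 2 ∂haarSU n =
      (a * a).trace / ((n : ℂ) ^ 2 - 1) * ((P * P).trace - P.trace ^ 2 / n) := by
  have h := integral_quadratic_orbit hn ha fun i j k l => P j i * P l k
  have hx (x : Matrix (Fin n) (Fin n) ℂ) : (P * x).trace ^ 2 =
      ∑ i, ∑ j, ∑ k, ∑ l, P j i * P l k * (x i j * x k l) := by
    have : (P * x).trace = ∑ i, ∑ j, P j i * x i j := by
      simp only [Matrix.trace, Matrix.diag_apply, Matrix.mul_apply]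
      exact Finset.sum_comm
    rw [this, sq]
    simp only [Finset.sum_mul, Finset.mul_sum]
    exact Finset.sum_congr rfl fun i _ => Finset.sum_congr rfl fun j _ =>
      Finset.sum_congr rfl fun k _ => Finset.sum_congr rfl fun l _ => by ring
  simp only [hx]
  rw [h]
  congr 2
  · simp only [Matrix.trace, Matrix.diag_apply, Matrix.mul_apply]
    exact Finset.sum_comm
  · rw [sq, Matrix.trace, Finset.sum_mul_sum]
    rfl

lemma integral_trace_mul_orbit (hn : n ≠ 0) {a : Matrix (Fin n) (Fin n) ℂ} (ha : a.trace = 0)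
    (P : Matrix (Fin n) (Fin n) ℂ) : ∫ g, (P * orbit a g).trace ∂haarSU n = 0 := by
  have h : ∫ g, (P * orbit a g).trace ∂haarSU n =
      haarMean n (∑ i, ∑ j, P i j • orbitEntry a j i) := by
    rw [haarMean_apply]
    simp only [ContinuousMap.sum_apply, ContinuousMap.smul_apply, orbitEntry_apply, smul_eq_mul,
      Matrix.trace, Matrix.diag_apply, Matrix.mul_apply]
  rw [h]
  simp [mean_orbitEntry hn ha]

/-- Tr [h, x]² = 2 Tr(hxhx) − 2 Tr(h²x²), put in the coefficient form that
`integral_quadratic_orbit` consumes. -/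
lemma trace_lie_sq (h x : Matrix (Fin n) (Fin n) ℂ) : (⁅h, x⁆ * ⁅h, x⁆).trace =
    ∑ i, ∑ j, ∑ k, ∑ l, (2 * (h l i * h j k) - 2 * (if j = k then (h * h) l i else 0)) *
      (x i j * x k l) := by
  have h1 : (h * x * (h * x)).trace = ∑ i, ∑ j, ∑ k, ∑ l, h l i * h j k * (x i j * x k l) := by
    have h1' : (h * x * (h * x)).trace = (x * (h * (x * h))).trace := by
      rw [mul_assoc, Matrix.trace_mul_comm]; simp only [mul_assoc]
    rw [h1']
    simp only [Matrix.trace, Matrix.diag_apply, Matrix.mul_apply, Finset.mul_sum]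
    exact Finset.sum_congr rfl fun i _ => Finset.sum_congr rfl fun j _ =>
      Finset.sum_congr rfl fun k _ => Finset.sum_congr rfl fun l _ => by ring
  have h2 : (h * h * (x * x)).trace =
      ∑ i, ∑ j, ∑ k, ∑ l, (if j = k then (h * h) l i else 0) * (x i j * x k l) := by
    have h2' : (h * h * (x * x)).trace = (x * (x * (h * h))).trace := by
      rw [Matrix.trace_mul_comm]; simp only [mul_assoc]
    have hk (i j : Fin n) : ∑ k, ∑ l, (if j = k then (h * h) l i else 0) * (x i j * x k l) =
        x i j * ∑ l, x j l * (h * h) l i := by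
      rw [Finset.sum_eq_single j]
      · rw [Finset.mul_sum]
        exact Finset.sum_congr rfl fun l _ => by rw [if_pos rfl]; ring
      · intro k _ hk
        exact Finset.sum_eq_zero fun l _ => by rw [if_neg hk.symm, zero_mul]
      · simp
    simp only [hk, h2']
    rfl
  have h3 : (⁅h, x⁆ * ⁅h, x⁆).trace = 2 * (h * x * (h * x)).trace - 2 * (h * h * (x * x)).trace := by
    have e : ⁅h, x⁆ * ⁅h, x⁆ = h * x * (h * x) - h * (x * x * h) - x * (h * h * x) + x * (h * x * h) := by
      rw [Ring.lie_def]; noncomm_ring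
    rw [e, Matrix.trace_add, Matrix.trace_sub, Matrix.trace_sub, Matrix.trace_mul_comm h (x * x * h),
      Matrix.trace_mul_comm x (h * h * x), Matrix.trace_mul_comm x (h * x * h),
      mul_assoc (x * x), Matrix.trace_mul_comm (x * x)]
    simp only [mul_assoc]
    ring
  rw [h3, h1, h2]
  simp only [Finset.mul_sum, ← Finset.sum_sub_distrib]
  exact Finset.sum_congr rfl fun i _ => Finset.sum_congr rfl fun j _ =>
    Finset.sum_congr rfl fun k _ => Finset.sum_congr rfl fun l _ => by ring

lemma integral_trace_lie_orbit_sq (hn : 2 ≤ n) {h o : Matrix (Fin n) (Fin n) ℂ} (hh : h.trace = 0)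
    (ho : o.trace = 0) :
    ∫ g, (⁅h, orbit o g⁆ * ⁅h, orbit o g⁆).trace ∂haarSU n =
      (o * o).trace / ((n : ℂ) ^ 2 - 1) * (-2 * n * (h * h).trace) := by
  simp only [trace_lie_sq]
  rw [integral_quadratic_orbit hn ho]
  congr 1
  have h1 : ∑ i, ∑ j, (2 * (h i i * h j j) - 2 * (if j = j then (h * h) i i else 0)) =
      2 * (h.trace * h.trace) - 2 * n * (h * h).trace := by
    simp only [if_true, Finset.sum_sub_distrib, ← Finset.mul_sum, Finset.sum_const, Finset.card_univ,
      Fintype.card_fin, nsmul_eq_mul, mul_assoc]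
    rw [← Finset.sum_mul]
    rfl
  -- The 1/n correction evaluates the quadratic form at x = 1, where [h, 1] = 0.
  have h2 : ∑ i, ∑ k, (2 * (h k i * h i k) - 2 * (if i = k then (h * h) k i else 0)) = 0 := by
    simp only [Finset.sum_sub_distrib, ← Finset.mul_sum, Finset.sum_ite_eq, Finset.mem_univ, if_true]
    rw [sub_eq_zero, Finset.sum_comm]
    simp only [Matrix.mul_apply]
  rw [h1, h2, hh]
  ring

lemma gradient_eq {h o : Matrix (Fin n) (Fin n) ℂ} {O : QOp n} (hO : oneBody o = Complex.I • O)
    (g₁ g₂ : SUn n) : gradient (oneBody h) O (plusState n) g₁ g₂ =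
      -Complex.I * (plusMat n * orbit ⁅h, orbit o g₁⁆ g₂).trace := by
  have hO' : O = -Complex.I • oneBody o := by rw [hO, smul_smul]; simp
  rw [gradient, hO', mul_smul_comm, smul_mul_assoc, compound_conj_oneBody g₁.conjTranspose_mul_self,
    lie_smul, oneBody_lie, mul_smul_comm, Matrix.trace_smul, smul_eq_mul, mul_assoc, mul_assoc,
    Matrix.trace_mul_comm, mul_assoc, compound_conj_oneBody g₂.conjTranspose_mul_self,
    trace_plusState_mul_oneBody]
  rfl

lemma orbit_conjTranspose {a : Matrix (Fin n) (Fin n) ℂ} (ha : aᴴ = -a) (g : SUn n) :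
    (orbit a g)ᴴ = -orbit a g := by
  simp [orbit, Matrix.conjTranspose_mul, ha, mul_assoc]

lemma orbit_mem_su {a : Matrix (Fin n) (Fin n) ℂ} (ha : a ∈ su n) (g : SUn n) :
    orbit a g ∈ su n :=
  ⟨orbit_conjTranspose ha.1 g, (orbit_trace a g).trans ha.2⟩

lemma re_trace_plusMat_mul {a : Matrix (Fin n) (Fin n) ℂ} (ha : a ∈ su n) :
    (plusMat n * a).trace.re = 0 := by
  have h := Matrix.trace_conjTranspose (plusMat n * a)
  rw [Matrix.conjTranspose_mul, ha.1, plusMat_conjTranspose, neg_mul, Matrix.trace_neg,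
    Matrix.trace_mul_comm] at h
  have := congrArg Complex.re h
  simp at this
  linarith

/-- The gradient is real, so the real part in `gradVar` loses nothing and the integrals may be
computed over ℂ. -/
lemma ofReal_re_gradient {h o : Matrix (Fin n) (Fin n) ℂ} (hh : h ∈ su n) (ho : o ∈ su n)
    {O : QOp n} (hO : oneBody o = Complex.I • O) (g₁ g₂ : SUn n) :
    ((gradient (oneBody h) O (plusState n) g₁ g₂).re : ℂ) =
      -Complex.I * (plusMat n * orbit ⁅h, orbit o g₁⁆ g₂).trace := by
  rw [gradient_eq hO]
  have := re_trace_plusMat_mul (orbit_mem_su (lie_mem_su hh (orbit_mem_su ho g₁)) g₂)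
  apply Complex.ext <;> simp [this]

lemma continuous_re_gradient {h o : Matrix (Fin n) (Fin n) ℂ} {O : QOp n}
    (hO : oneBody o = Complex.I • O) :
    Continuous fun p : SUn n × SUn n => (gradient (oneBody h) O (plusState n) p.1 p.2).re := by
  simp only [gradient_eq hO, orbit, Ring.lie_def]
  fun_prop

lemma trace_mul_self_of_su {a : Matrix (Fin n) (Fin n) ℂ} (ha : a ∈ su n) :
    (a * a).trace = -(stdNormSq a : ℂ) := by
  have h := Matrix.trace_conjTranspose (a * a)
  rw [Matrix.conjTranspose_mul, ha.1, neg_mul_neg] at h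
  have := congrArg Complex.im h
  simp at this
  apply Complex.ext
  · simp [stdNormSq]
  · simp; linarith

theorem gradVar_plusState (hn : 2 ≤ n) {h o : Matrix (Fin n) (Fin n) ℂ} (hh : h ∈ su n)
    (ho : o ∈ su n) {O : QOp n} (hO : oneBody o = Complex.I • O) :
    gradVar (oneBody h) O (plusState n) =
      (n * (n - 1) : ℝ) / (4 * ((n : ℝ) ^ 2 - 1) ^ 2) * stdNormSq h * stdNormSq o := by
  have hn0 : n ≠ 0 := by omega
  have hc := continuous_re_gradient (h := h) hO
  set f : SUn n × SUn n → ℝ := fun p => (gradient (oneBody h) O (plusState n) p.1 p.2).re with hf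
  have hfC (g₁ g₂ : SUn n) : (f (g₁, g₂) : ℂ) =
      -Complex.I * (plusMat n * orbit ⁅h, orbit o g₁⁆ g₂).trace := ofReal_re_gradient hh ho hO g₁ g₂
  have htr (g : SUn n) : (⁅h, orbit o g⁆).trace = 0 := (lie_mem_su hh (orbit_mem_su ho g)).2
  have hint (F : SUn n × SUn n → ℂ) (hF : Continuous F) :
      Integrable F ((haarSU n).prod (haarSU n)) :=
    hF.integrable_of_hasCompactSupport (HasCompactSupport.of_compactSpace _)
  have hmean : ∫ p, f p ∂(haarSU n).prod (haarSU n) = 0 := by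
    have : ((∫ p, f p ∂(haarSU n).prod (haarSU n) : ℝ) : ℂ) = 0 := by
      rw [← integral_complex_ofReal, integral_prod _ (hint _ (by fun_prop))]
      simp only [hfC, integral_const_mul, integral_trace_mul_orbit hn0 (htr _), mul_zero,
        integral_zero]
    exact_mod_cast this
  have hsq : ∫ p, f p ^ 2 ∂(haarSU n).prod (haarSU n) =
      (n * (n - 1) : ℝ) / (4 * ((n : ℝ) ^ 2 - 1) ^ 2) * stdNormSq h * stdNormSq o := by
    rw [← Complex.ofReal_inj, ← integral_complex_ofReal]
    simp only [Complex.ofReal_pow]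
    -- The inner average is over g⁻: for fixed g⁺ the bracket is a traceless matrix, and its squared
    -- trace is then averaged over g⁺.
    rw [integral_prod _ (hint _ (by fun_prop))]
    simp only [hfC, mul_pow, integral_const_mul, integral_trace_mul_orbit_sq hn (htr _),
      integral_mul_const, integral_div, integral_trace_lie_orbit_sq hn hh.2 ho.2, neg_sq, Complex.I_sq,
      trace_mul_self_of_su hh, trace_mul_self_of_su ho, trace_plusMat, trace_plusMat_mul_self hn0]
    have hnC : (n : ℂ) ≠ 0 := Nat.cast_ne_zero.mpr hn0
    have hd : (n : ℂ) ^ 2 - 1 ≠ 0 := by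
      have : ((n ^ 2 : ℕ) : ℂ) ≠ (1 : ℕ) := by
        rw [Ne, Nat.cast_inj]
        nlinarith
      push_cast at this
      exact sub_ne_zero.mpr this
    push_cast
    field_simp
    ring
  rw [gradVar, ProbabilityTheory.variance_eq_sub]
  · change ∫ p, f p ^ 2 ∂_ - (∫ p, f p ∂_) ^ 2 = _
    rw [hmean, hsq]
    ring
  · exact hc.memLp_of_hasCompactSupport (HasCompactSupport.of_compactSpace _)

end Variance

/-! ### Rates -/

lemma isTheta_gradVar_prefactor :
    (fun n : ℕ => (n * (n - 1) : ℝ) / (4 * ((n : ℝ) ^ 2 - 1) ^ 2)) =Θ[atTop]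
      fun n : ℕ => 1 / (n : ℝ) ^ 2 := by
  -- The bounds 1 and 8 are crude: they come from n² − 1 ≥ 3n²/4 and n(n − 1) ≥ n²/2, both valid
  -- from n = 2.
  have key (n : ℕ) (hn : 2 ≤ n) : 0 ≤ (n * (n - 1) : ℝ) ∧ 0 < (n : ℝ) ^ 2 ∧
      0 < 4 * ((n : ℝ) ^ 2 - 1) ^ 2 ∧ (n * (n - 1) : ℝ) * n ^ 2 ≤ 4 * ((n : ℝ) ^ 2 - 1) ^ 2 ∧
      4 * ((n : ℝ) ^ 2 - 1) ^ 2 ≤ 8 * (n * (n - 1) : ℝ) * n ^ 2 := by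
    have hx : (2 : ℝ) ≤ n := by exact_mod_cast hn
    generalize (n : ℝ) = x at hx
    have h1 : 3 / 4 * x ^ 2 ≤ x ^ 2 - 1 := by nlinarith
    have h2 : (3 / 4 * x ^ 2) ^ 2 ≤ (x ^ 2 - 1) ^ 2 := pow_le_pow_left₀ (by positivity) h1 2
    have h3 : (x ^ 2 - 1) ^ 2 ≤ (x ^ 2) ^ 2 := pow_le_pow_left₀ (by nlinarith) (by linarith) 2
    have h4 : x ^ 2 / 2 ≤ x * (x - 1) := by nlinarith
    have h5 : x ^ 2 / 2 * x ^ 2 ≤ x * (x - 1) * x ^ 2 :=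
      mul_le_mul_of_nonneg_right h4 (by positivity)
    have h6 : x * (x - 1) * x ^ 2 ≤ x ^ 2 * x ^ 2 :=
      mul_le_mul_of_nonneg_right (by nlinarith) (by positivity)
    have h7 : 0 < x ^ 2 * x ^ 2 := by positivity
    refine ⟨by nlinarith, by positivity, ?_, ?_, ?_⟩ <;> nlinarith
  refine ⟨IsBigO.of_bound 1 ?_, IsBigO.of_bound 8 ?_⟩ <;>
    filter_upwards [eventually_ge_atTop 2] with n hn <;>
    obtain ⟨h0, h1, h2, h3, h4⟩ := key n hn <;>
    rw [Real.norm_of_nonneg (by positivity), Real.norm_of_nonneg (by positivity)]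
  · rw [one_mul, div_le_div_iff₀ h2 h1, one_mul]
    exact h3
  · rw [← mul_div_assoc, div_le_div_iff₀ h1 h2, one_mul]
    exact h4

lemma isTheta_inv_finrank_dla :
    (fun n : ℕ => 1 / (Module.finrank ℝ (dla n) : ℝ)) =Θ[atTop] fun n : ℕ => 1 / (n : ℝ) ^ 2 := by
  have hd : ∀ᶠ n : ℕ in atTop, (Module.finrank ℝ (dla n) : ℝ) = (n : ℝ) ^ 2 - 1 ∧ (2 : ℝ) ≤ n := by
    filter_upwards [eventually_ge_atTop 2] with n hn
    refine ⟨?_, by exact_mod_cast hn⟩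
    rw [finrank_dla (by omega), Nat.cast_sub (Nat.one_le_pow _ _ (by omega))]
    simp
  refine ⟨IsBigO.of_bound 2 ?_, IsBigO.of_bound 1 ?_⟩
  · filter_upwards [hd] with n ⟨hn, h2⟩
    have h : 0 < (n : ℝ) ^ 2 - 1 := by nlinarith
    rw [hn, Real.norm_of_nonneg (by positivity), Real.norm_of_nonneg (by positivity), mul_one_div,
      div_le_div_iff₀ (by positivity) (by positivity)]
    nlinarith
  · filter_upwards [hd] with n ⟨hn, h2⟩
    have h : 0 < (n : ℝ) ^ 2 - 1 := by nlinarith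
    rw [hn, Real.norm_of_nonneg (by positivity), Real.norm_of_nonneg (by positivity), one_mul,
      div_le_div_iff₀ (by positivity) (by positivity)]
    nlinarith

end CompoundAnsatz

/-! ### Assembly of the algebraic, variance and rate statements. -/

theorem theorem6 :
    (∀ n : ℕ, 2 ≤ n →
      -- the dynamical Lie algebra is the image of `su(n)` and has dimension `n² - 1`
      (dla n : Set (QOp n)) = dcompound '' su n ∧
      Module.finrank ℝ (dla n) = n ^ 2 - 1 ∧
      -- the generators have squared standard norm `1/2`
      (∀ H ∈ generators n, ∃ h ∈ su n, dcompound h = H ∧ stdNormSq h = 1 / 2) ∧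
      -- the gradient variance of a general LASA
      (∀ h ∈ su n, ∀ o ∈ su n, ∀ O : QOp n, IsLASA n O → dcompound o = Complex.I • O →
        gradVar (dcompound h) O (plusState n) =
          (n * (n - 1) : ℝ) / (4 * ((n : ℝ) ^ 2 - 1) ^ 2) * stdNormSq h * stdNormSq o) ∧
      -- the gradient variance when the observable is `± i` times a generator
      (∀ H ∈ generators n, ∀ K ∈ generators n, ∀ O : QOp n,
        (O = Complex.I • K ∨ O = -(Complex.I • K)) →
        gradVar H O (plusState n) = (n * (n - 1) : ℝ) / (16 * ((n : ℝ) ^ 2 - 1) ^ 2))) ∧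
    -- the rate, for every sequence of LASAs with observables of order one
    (∀ (H O : ∀ n : ℕ, QOp n) (o : ∀ n : ℕ, Matrix (Fin n) (Fin n) ℂ),
      (∀ n, 2 ≤ n → H n ∈ generators n ∧ IsLASA n (O n) ∧
        o n ∈ su n ∧ dcompound (o n) = Complex.I • O n) →
      (fun n => stdNormSq (o n)) =Θ[atTop] (fun _ => (1 : ℝ)) →
      (fun n => gradVar (H n) (O n) (plusState n)) =Θ[atTop] (fun n : ℕ => 1 / (n : ℝ) ^ 2) ∧
      (fun n => gradVar (H n) (O n) (plusState n)) =Θ[atTop]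
        (fun n : ℕ => 1 / (Module.finrank ℝ (dla n) : ℝ))) := by
  refine ⟨fun n hn => ⟨?_, finrank_dla (by omega), fun H hH => ?_, ?_, ?_⟩, ?_⟩
  · rw [dla_eq_suImage]
    ext A
    simp only [Set.mem_image, dcompound_eq_oneBody]
    exact mem_suImage
  · simpa only [dcompound_eq_oneBody] using exists_su_of_mem_generators hH
  · intro h hh o ho O _ hO
    rw [dcompound_eq_oneBody] at hO ⊢
    exact gradVar_plusState hn hh ho hO
  · intro H hH K hK O hO
    obtain ⟨h, hh, rfl, hh2⟩ := exists_su_of_mem_generators hH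
    obtain ⟨k, hk, rfl, hk2⟩ := exists_su_of_mem_generators hK
    obtain ⟨o, ho, hoO, ho2⟩ : ∃ o ∈ su n, oneBody o = Complex.I • O ∧ stdNormSq o = 1 / 2 := by
      -- For O = iK one has iO = −K, so the preimage is `-k`; for O = −iK it is `k`.
      rcases hO with rfl | rfl
      · exact ⟨-k, (suSubmodule n).neg_mem hk, by simp [smul_smul], by simpa [stdNormSq] using hk2⟩
      · exact ⟨k, hk, by simp [smul_smul], hk2⟩
    rw [gradVar_plusState hn hh ho hoO, hh2, ho2]
    have hd : (n : ℝ) ^ 2 - 1 ≠ 0 := by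
      have : (2 : ℝ) ≤ n := by exact_mod_cast hn
      nlinarith
    field_simp
    ring
  · intro H O o hseq ho
    have hvar : (fun n => gradVar (H n) (O n) (plusState n)) =ᶠ[atTop] fun n : ℕ =>
        (n * (n - 1) : ℝ) / (4 * ((n : ℝ) ^ 2 - 1) ^ 2) * (1 / 2 * stdNormSq (o n)) := by
      filter_upwards [eventually_ge_atTop 2] with n hn
      obtain ⟨hH, -, hos, hoO⟩ := hseq n hn
      obtain ⟨h, hh, hhH, hh2⟩ := exists_su_of_mem_generators hH
      rw [dcompound_eq_oneBody] at hoO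
      rw [← hhH, gradVar_plusState hn hh hos hoO, hh2, mul_assoc]
    have hrate : (fun n => gradVar (H n) (O n) (plusState n)) =Θ[atTop]
        fun n : ℕ => 1 / (n : ℝ) ^ 2 := by
      refine hvar.trans_isTheta ?_
      have ho' : (fun n => 1 / 2 * stdNormSq (o n)) =Θ[atTop] fun _ => (1 : ℝ) :=
        ho.const_mul_left (by norm_num)
      simpa using isTheta_gradVar_prefactor.mul ho'
    exact ⟨hrate, hrate.trans isTheta_inv_finrank_dla.symm⟩
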